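/- For $g,d\in\mathbb{N}$ let $\mathcal{A}_g=\{0,1,\dots,g\}$ and let $$X_g^d=\{x\in\mathcal{A}_g^{\mathbb{Z}^d}: |x(p)-x(p+e_i)|\le 1 \text{ for all } p\in\mathbb{Z}^d,\ i=1,\dots,d\}.$$ For $\lambda>0$ let $\Phi_\lambda$ be the shift-invariant nearest-neighbour interaction with $\Phi_\lambda(m)=-m\log\lambda$ on single sites and, on edges, $\Phi_\lambda(mn)=0$ if $|m-n|\le1$ and $\Phi_\lambda(mn)=\infty$ otherwise. For a finite set $S\subset\mathbb{Z}^d$ let $\partial S$ be the set of sites outside $S$ that are adjacent to a site of $S$. For a configuration $w$ with finite shape $T$ let $U(w)$ be the sum of $\Phi_\lambda$ over all sites of $T$ and all edges contained in $T$. A shift-invariant Borel probability measure $\mu$ on $\mathcal{A}_g^{\mathbb{Z}^d}$ is a Markov random field if $\mu(u\mid\delta)=\mu(u\mid\delta(\partial S))$ for all finite $S$, all $u\in\mathcal{A}_g^S$, all finite $T$ with $\partial S\subseteq T\subseteq\mathbb{Z}^d\setminus S$ and all $\delta\in\mathcal{A}_g^T$ with $\mu(\delta)>0$. It is a (stationary)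 nearest-neighbour Gibbs measure for $\Phi_\lambda$ if it is a Markov random field and, for every finite $S$ and every $\delta\in\mathcal{A}_g^{\partial S}$ with $\mu(\delta)>0$, the number $Z=\sum_{w\in\mathcal{A}_g^S}e^{-U(w\delta)}$ is positive and $\mu(w\mid\delta)=e^{-U(w\delta)}/Z$ for all $w\in\mathcal{A}_g^S$. A Markov random field $\mu$ satisfies strong spatial mixing (SSM) with rate $f$, where $f:\mathbb{N}\to[0,\infty)$ and $f(n)\to0$, if for all finite $W\subset\mathbb{Z}^d$, all $U\subseteq W$, $u\in\mathcal{A}_g^U$ and $\delta_1,\delta_2\in\mathcal{A}_g^{\partial W}$ with $\mu(\delta_1),\mu(\delta_2)>0$, $$|\mu(u\mid\delta_1)-\mu(u\mid\delta_2)|\le |U|\,f\big(\mathrm{dist}(U,\{p\in\partial W:\delta_1(p)\ne\delta_2(p)\})\big),$$ where $\mathrm{dist}$ is the $\ell^1$ distance, the distance to the empty set is $\infty$ and $f(\infty)=0$. **Proposition.** For all $g,d\in\mathbb{N}$ and every $\alpha>0$ there is $\lambda_0>0$ such that for every $\lambda\ge\lambda_0$ the underlying shift space $\{x\in\mathcal{A}_g^{\mathbb{Z}^d}:\Phi_\lambda(x(\{p,p+e_i\}))\neq\infty\text{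 for all }p,i\}$ of $\Phi_\lambda$ is $X_g^d$, and there is a stationary nearest-neighbour Gibbs measure $\mu$ for $\Phi_\lambda$ with $\mathrm{supp}(\mu)=X_g^d$ that satisfies exponential SSM with rate $f(n)=Ce^{-\alpha n}$ for some $C>0$. -/

import Mathlib

open MeasureTheory ProbabilityTheory Filter Topology

noncomputable section

namespace SSM

/-- The sites of the `d`-dimensional cubic lattice. -/
abbrev Site (d : ℕ) : Type := Fin d → ℤ

/-- The canonical basis vector `e_i`. -/
def basisVec {d : ℕ} (i : Fin d) : Site d := Pi.single i 1

/-- The norm `‖p‖ = ∑ i, |p i|`. -/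
def l1norm {d : ℕ} (p : Site d) : ℕ := ∑ i, (p i).natAbs

/-- The distance `min ‖p - q‖` over `p ∈ A`, `q ∈ B`; it is `⊤` if one of the sets is empty. -/
def setDist {d : ℕ} (A B : Set (Site d)) : ℕ∞ :=
  ⨅ p ∈ A, ⨅ q ∈ B, ((l1norm (p - q) : ℕ) : ℕ∞)

/-- The outer boundary `∂S` of a finite set of sites; see `mem_boundary`. -/
def boundary {d : ℕ} (S : Finset (Site d)) : Finset (Site d) :=
  (S.biUnion fun p => Finset.univ.biUnion fun i : Fin d => {p + basisVec i, p - basisVec i}) \ S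

theorem l1norm_eq_one_iff {d : ℕ} (p : Site d) :
    l1norm p = 1 ↔ ∃ i, p = basisVec i ∨ p = -basisVec i := by
  constructor
  · intro h
    unfold l1norm at h
    have hex : ∃ i, p i ≠ 0 := by
      by_contra hcon
      push Not at hcon
      simp [hcon] at h
    obtain ⟨i, hi⟩ := hex
    have hsplit := Finset.add_sum_erase Finset.univ (fun j => (p j).natAbs) (Finset.mem_univ i)
    have hpos : 0 < (p i).natAbs := Int.natAbs_pos.mpr hi
    have hrest : ∑ j ∈ Finset.univ.erase i, (p j).natAbs = 0 := by omega
    have hone : (p i).natAbs = 1 := by omega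
    rw [Finset.sum_eq_zero_iff] at hrest
    have hz : ∀ j, j ≠ i → p j = 0 := fun j hj =>
      Int.natAbs_eq_zero.mp (hrest j (Finset.mem_erase.mpr ⟨hj, Finset.mem_univ j⟩))
    refine ⟨i, ?_⟩
    rcases Int.natAbs_eq (p i) with h1 | h1
    · left
      ext j
      by_cases hj : j = i
      · subst hj
        rw [h1, hone]
        simp [basisVec]
      · simp [basisVec, hz j hj, Pi.single_eq_of_ne hj]
    · right
      ext j
      by_cases hj : j = i
      · subst hj
        rw [h1, hone]
        simp [basisVec]
      · simp [basisVec, hz j hj, Pi.single_eq_of_ne hj]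
  · rintro ⟨i, rfl | rfl⟩
    · unfold l1norm basisVec
      rw [Finset.sum_eq_single i] <;> simp +contextual
    · unfold l1norm basisVec
      rw [Finset.sum_eq_single i] <;> simp +contextual

/-- A site lies in `∂S` iff it is outside `S` and adjacent to some site of `S`. -/
theorem mem_boundary {d : ℕ} (S : Finset (Site d)) (p : Site d) :
    p ∈ boundary S ↔ p ∉ S ∧ ∃ q ∈ S, l1norm (p - q) = 1 := by
  simp only [boundary, Finset.mem_sdiff, Finset.mem_biUnion, Finset.mem_univ, true_and,
    Finset.mem_insert, Finset.mem_singleton, l1norm_eq_one_iff]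
  constructor
  · rintro ⟨⟨q, hq, i, h | h⟩, hp⟩
    · exact ⟨hp, q, hq, i, Or.inl (by rw [h]; abel)⟩
    · exact ⟨hp, q, hq, i, Or.inr (by rw [h]; abel)⟩
  · rintro ⟨hp, q, hq, i, h | h⟩
    · exact ⟨⟨q, hq, i, Or.inl (by rw [← h]; abel)⟩, hp⟩
    · exact ⟨⟨q, hq, i, Or.inr (by rw [sub_eq_add_neg, ← h]; abel)⟩, hp⟩

/-- A point of the full shift over the alphabet `A`. -/
abbrev Point (A : Type*) (d : ℕ) := Site d → A

/-- A configuration with finite shape `S`. -/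
abbrev Config {d : ℕ} (A : Type*) (S : Finset (Site d)) := S → A

/-- The cylinder set `[u]` in the full shift. -/
def cyl {A : Type*} {d : ℕ} {S : Finset (Site d)} (u : Config A S) : Set (Point A d) :=
  {x | S.restrict x = u}

/-- The concatenation `uv` (it is used for disjoint shapes only). -/
def concat {A : Type*} {d : ℕ} {S T : Finset (Site d)} (u : Config A S) (v : Config A T) :
    Config A (S ∪ T) :=
  fun p => if h : p.1 ∈ S then u ⟨p.1, h⟩
    else v ⟨p.1, (Finset.mem_union.mp p.2).resolve_left h⟩

/-- The set of sites at which two configurations of the same shape differ. -/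
def disagreement {A : Type*} {d : ℕ} {S : Finset (Site d)} (s₁ s₂ : Config A S) : Set (Site d) :=
  {p | ∃ h : p ∈ S, s₁ ⟨p, h⟩ ≠ s₂ ⟨p, h⟩}

/-- The shift action `(σ_p x)(q) = x(p + q)`. -/
def shift {A : Type*} {d : ℕ} (p : Site d) (x : Point A d) : Point A d := fun q => x (p + q)

/-- Markov random fields; as usual in this setting they are shift-invariant probability measures.
`μ[s | t]` is the conditional probability of `s` given `t`. -/
structure IsMRF {A : Type*} [MeasurableSpace A] {d : ℕ} (μ : Measure (Point A d)) : Prop where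
  isProbabilityMeasure : IsProbabilityMeasure μ
  shift_invariant : ∀ p : Site d, MeasurePreserving (shift p) μ μ
  markov : ∀ (S T : Finset (Site d)) (hT : boundary S ⊆ T), Disjoint T S →
    ∀ (u : Config A S) (δ : Config A T), 0 < μ (cyl δ) →
      μ[cyl u | cyl δ] = μ[cyl u | cyl (Finset.restrict₂ (π := fun _ => A) hT δ)]

/-- The conditional probability `μ^δ(u) = μ([u] | [δ])`, as a real number. -/
def condProb {A : Type*} [MeasurableSpace A] {d : ℕ} (μ : Measure (Point A d))
    {S T : Finset (Site d)} (δ : Config A T) (u : Config A S) : ℝ :=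
  (μ[cyl u | cyl δ]).toReal

/-- A (shift-invariant) nearest-neighbour interaction, given by its values on configurations on
single sites and on the edges `{p, p + e_i}`; it may be infinite on edges (hard constraints). -/
structure NNInteraction (A : Type*) (d : ℕ) where
  site : A → ℝ
  edge : Fin d → A → A → WithTop ℝ

/-- The underlying nearest-neighbour SFT of an interaction. -/
def NNInteraction.sft {A : Type*} {d : ℕ} (Φ : NNInteraction A d) : Set (Point A d) :=
  {x | ∀ (p : Site d) (i : Fin d), Φ.edge i (x p) (x (p + basisVec i)) ≠ ⊤}

/-- The energy of a configuration: the interaction summed over all sites of its shape and over all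
edges `{p, p + e_i}` contained in its shape. -/
def NNInteraction.energy {A : Type*} {d : ℕ} (Φ : NNInteraction A d) {S : Finset (Site d)}
    (w : Config A S) : WithTop ℝ :=
  (∑ p : S, ((Φ.site (w p) : ℝ) : WithTop ℝ)) +
    ∑ i : Fin d, ∑ p : S,
      if h : p.1 + basisVec i ∈ S then Φ.edge i (w p) (w ⟨p.1 + basisVec i, h⟩) else 0

/-- The function `U ↦ e^{-U}`, with `e^{-∞} = 0`. -/
def expNeg (U : WithTop ℝ) : ℝ := WithTop.recTopCoe 0 (fun r : ℝ => Real.exp (-r)) U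

/-- The partition function `∑ w, e^{-U(wδ)}` of `S` with boundary condition `δ` on `∂S`. -/
def NNInteraction.partitionFn {A : Type*} [Fintype A] {d : ℕ} (Φ : NNInteraction A d)
    (S : Finset (Site d)) (δ : Config A (boundary S)) : ℝ :=
  ∑ w : Config A S, expNeg (Φ.energy (concat w δ))

/-- The Gibbs specification `Λ_S^δ(w) = e^{-U(wδ)} / Z`, meaningful if `Z > 0`. -/
def NNInteraction.spec {A : Type*} [Fintype A] {d : ℕ} (Φ : NNInteraction A d)
    (S : Finset (Site d)) (δ : Config A (boundary S)) (w : Config A S) : ℝ :=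
  expNeg (Φ.energy (concat w δ)) / Φ.partitionFn S δ

/-- Stationary nearest-neighbour Gibbs measures for the interaction `Φ`. -/
structure IsNNGibbs {A : Type*} [Fintype A] [MeasurableSpace A] {d : ℕ}
    (Φ : NNInteraction A d) (μ : Measure (Point A d)) : Prop where
  isMRF : IsMRF μ
  gibbs : ∀ (S : Finset (Site d)) (δ : Config A (boundary S)), 0 < μ (cyl δ) →
    0 < Φ.partitionFn S δ ∧ ∀ w : Config A S, condProb μ δ w = Φ.spec S δ w

/-- The value of a rate function at a possibly infinite distance, with `f(∞) = 0`. -/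
def rateAt (f : ℕ → ℝ) (n : ℕ∞) : ℝ := ENat.recTopCoe 0 f n

/-- Strong spatial mixing with rate `f` of a Markov random field. -/
structure IsSSM {A : Type*} [MeasurableSpace A] {d : ℕ} (μ : Measure (Point A d))
    (f : ℕ → ℝ) : Prop where
  isMRF : IsMRF μ
  rate_nonneg : ∀ n, 0 ≤ f n
  rate_tendsto : Tendsto f atTop (𝓝 0)
  mixing : ∀ (W U : Finset (Site d)), U ⊆ W →
    ∀ (u : Config A U) (δ₁ δ₂ : Config A (boundary W)), 0 < μ (cyl δ₁) → 0 < μ (cyl δ₂) →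
      |condProb μ δ₁ u - condProb μ δ₂ u| ≤
        (U.card : ℝ) * rateAt f (setDist (U : Set (Site d)) (disagreement δ₁ δ₂))

/-- The nearest-neighbour SFT `X_g^d`: values in `{0, …, g}`, neighbours differ by at most `1`. -/
def stepShift (g d : ℕ) : Set (Point (Fin (g + 1)) d) :=
  {x | ∀ (p : Site d) (i : Fin d), |((x p : ℕ) : ℤ) - ((x (p + basisVec i) : ℕ) : ℤ)| ≤ 1}

/-- The interaction with activity `lam`: `Φ(m) = -m log lam` on sites, and on edges
`Φ(mn) = 0` if `|m - n| ≤ 1` and `∞` otherwise. -/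
def stepInteraction (g d : ℕ) (lam : ℝ) : NNInteraction (Fin (g + 1)) d where
  site m := -((m : ℕ) : ℝ) * Real.log lam
  edge _ m n := if |((m : ℕ) : ℤ) - ((n : ℕ) : ℤ)| ≤ 1 then 0 else ⊤

end SSM

end

/-! Under a boundary condition the weight of a configuration is `lam` to the sum of its values, so a
large `lam` favours large values. Since a pointwise maximum of admissible points is admissible,
there is one largest extension `maxPoint`. Values are at most `g` and change by at most one per
step, so a boundary site influences this extension only at distances below `g`
(`maxPoint_eq_of_far`).

Call a site a defect if the configuration lies below `maxPoint` there. Raising the values by one on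
a connected component `K` of defects stays admissible, is injective for fixed `K`, and gains the
factor `lam ^ K.card`. This Peierls argument is run on two independent configurations with boundary
conditions `ξ₁`, `ξ₂` and on components of the union of their defect sets. Recording which part of
`K` belongs to which configuration costs `4 ^ K.card`; the possible `K` through a given site are
controlled by `sum_animals_le_one`, at the cost of `2 ^ ((2 * d + 1) * K.card)`. Hence a component
with at least `m` sites has probability at most `(2 ^ (2 * d + 3) / lam) ^ m`
(`sum_le_card_defectComponent_le`).

Mixing follows by swapping (`abs_prob_sub_prob_le`). If the sites of disagreement connected to `U`
stay inside `W`, exchanging the two configurations on them is a weight-preserving involution that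
swaps the values on `U`, so such pairs contribute nothing to the difference of probabilities.
Otherwise the cluster reaches a boundary site where `ξ₁` and `ξ₂` differ. Far from such sites the
two maxima coincide, so a disagreement there is a defect of one configuration, and a large defect
component must exist.

The infinite-volume measure is a limit point of finite-volume distributions (`exists_isDLR`). The
same estimate makes it unique, hence shift-invariant. Full support holds because any admissible
pattern can be joined to any distant admissible boundary condition by passing through the value `g`
(`exists_interpolation`). -/

namespace SSM

/-! ### Adjacency and connected components in the lattice -/

/-- Nearest neighbours of the lattice. -/
def Adj {d : ℕ} (p q : Site d) : Prop := l1norm (p - q) = 1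

theorem l1norm_sub_comm {d : ℕ} (p q : Site d) : l1norm (p - q) = l1norm (q - p) := by
  unfold l1norm
  refine Finset.sum_congr rfl fun i _ => ?_
  simp only [Pi.sub_apply]
  omega

theorem l1norm_sub_le {d : ℕ} (p q r : Site d) :
    l1norm (p - r) ≤ l1norm (p - q) + l1norm (q - r) := by
  unfold l1norm
  rw [← Finset.sum_add_distrib]
  refine Finset.sum_le_sum fun i _ => ?_
  simp only [Pi.sub_apply]
  omega

@[simp] theorem l1norm_zero {d : ℕ} : l1norm (0 : Site d) = 0 := by simp [l1norm]

theorem Adj.symm {d : ℕ} {p q : Site d} (h : Adj p q) : Adj q p := by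
  unfold Adj at *
  rw [l1norm_sub_comm, h]

theorem Adj.l1norm_le {d : ℕ} {p q : Site d} (h : Adj p q) (r : Site d) :
    l1norm (p - r) ≤ l1norm (q - r) + 1 := by
  have := l1norm_sub_le p q r
  unfold Adj at h
  omega

theorem adj_add_basisVec {d : ℕ} (p : Site d) (i : Fin d) : Adj p (p + basisVec i) := by
  refine Adj.symm ((l1norm_eq_one_iff _).2 ⟨i, Or.inl ?_⟩)
  abel

theorem mem_boundary_of_adj {d : ℕ} {S : Finset (Site d)} {p q : Site d} (hp : p ∈ S)
    (hq : q ∉ S) (h : Adj p q) : q ∈ boundary S :=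
  (mem_boundary S q).2 ⟨hq, p, hp, h.symm⟩

theorem disjoint_boundary {d : ℕ} (S : Finset (Site d)) : Disjoint (boundary S) S :=
  Finset.disjoint_left.2 fun p hp => ((mem_boundary S p).1 hp).1

theorem card_boundary_le {d : ℕ} (S : Finset (Site d)) : (boundary S).card ≤ 2 * d * S.card := by
  refine (Finset.card_le_card Finset.sdiff_subset).trans ?_
  refine (Finset.card_biUnion_le_card_mul _ _ (2 * d) fun p _ => ?_).trans (by rw [mul_comm])
  refine (Finset.card_biUnion_le_card_mul _ _ 2 fun i _ => Finset.card_le_two).trans ?_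
  simp [mul_comm]

open scoped Classical in
/-- The connected component of `p` in `S`; it is empty if `p ∉ S`. -/
noncomputable def component {d : ℕ} (S : Finset (Site d)) (p : Site d) : Finset (Site d) :=
  S.filter fun q => Relation.ReflTransGen (fun a b => a ∈ S ∧ b ∈ S ∧ Adj a b) p q

theorem mem_component {d : ℕ} {S : Finset (Site d)} {p q : Site d} : q ∈ component S p ↔
    q ∈ S ∧ Relation.ReflTransGen (fun a b => a ∈ S ∧ b ∈ S ∧ Adj a b) p q := by
  simp only [component, Finset.mem_filter]

theorem component_subset {d : ℕ} (S : Finset (Site d)) (p : Site d) : component S p ⊆ S :=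
  fun _ hq => (mem_component.1 hq).1

theorem self_mem_component {d : ℕ} {S : Finset (Site d)} {p : Site d} (hp : p ∈ S) :
    p ∈ component S p :=
  mem_component.2 ⟨hp, Relation.ReflTransGen.refl⟩

theorem mem_component_of_adj {d : ℕ} {S : Finset (Site d)} {p q r : Site d}
    (hq : q ∈ component S p) (hr : r ∈ S) (h : Adj q r) : r ∈ component S p := by
  rw [mem_component] at *
  exact ⟨hr, hq.2.tail ⟨hq.1, hr, h⟩⟩

theorem component_induction {d : ℕ} {S : Finset (Site d)} {p : Site d} {P : Site d → Prop}
    (hp : p ∈ S → P p)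
    (hs : ∀ q ∈ component S p, ∀ r ∈ component S p, Adj q r → P q → P r) :
    ∀ q ∈ component S p, P q := by
  intro q hq
  have h := (mem_component.1 hq).2
  induction h with
  | refl => exact hp (component_subset _ _ hq)
  | @tail b c hb hbc ih =>
    have hb' : b ∈ component S p := mem_component.2 ⟨hbc.1, hb⟩
    exact hs b hb' c hq hbc.2.2 (ih hb')

theorem mem_of_mem_component {d : ℕ} {S : Finset (Site d)} {p q : Site d}
    (hq : q ∈ component S p) : p ∈ S := by
  obtain ⟨hqS, h⟩ := mem_component.1 hq
  rcases Relation.ReflTransGen.cases_head h with rfl | ⟨c, hc, _⟩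
  · exact hqS
  · exact hc.1

/-- A path leaving the component would have to step onto its boundary, which `T` avoids. This lets
sites away from `K ∪ boundary K` be chosen freely in the counting of connected sets. -/
theorem component_union_eq {d : ℕ} {S T : Finset (Site d)} {p : Site d} (hp : p ∈ S)
    (hT : Disjoint T (boundary (component S p))) :
    component (component S p ∪ T) p = component S p := by
  have hpK := self_mem_component hp
  refine Finset.Subset.antisymm ?_ ?_
  · refine component_induction (fun _ => hpK) fun q _ r hr hqr hqK => ?_
    by_contra hrK
    rcases Finset.mem_union.1 (component_subset _ _ hr) with h | h
    · exact hrK h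
    · exact Finset.disjoint_left.1 hT h (mem_boundary_of_adj hqK hrK hqr)
  · refine component_induction
      (fun _ => self_mem_component (Finset.mem_union_left _ hpK)) fun q _ r hr hqr hqK => ?_
    exact mem_component_of_adj hqK (Finset.mem_union_left _ hr) hqr

/-- Along a path from `p` the distance to `p` changes by at most one per step, so the component
realises every distance from `0` to `l1norm (q - p)`. -/
theorem l1norm_lt_card_component {d : ℕ} {S : Finset (Site d)} {p q : Site d}
    (hq : q ∈ component S p) : l1norm (q - p) < (component S p).card := by
  have hp := mem_of_mem_component hq
  have key : ∀ q ∈ component S p, ∀ j ≤ l1norm (q - p), ∃ r ∈ component S p,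
      l1norm (r - p) = j := by
    refine component_induction (fun _ j hj => ?_) fun q hq r hr hqr ih j hj => ?_
    · refine ⟨p, self_mem_component hp, ?_⟩
      simp only [sub_self, l1norm_zero] at *
      omega
    · have := hqr.symm.l1norm_le p
      rcases Nat.lt_or_ge (l1norm (q - p)) j with h | h
      · exact ⟨r, hr, by omega⟩
      · exact ih j h
  have hsub : Finset.range (l1norm (q - p) + 1) ⊆
      (component S p).image fun r => l1norm (r - p) := by
    intro j hj
    obtain ⟨r, hr, hrj⟩ := key q hq j (by simpa [Nat.lt_succ_iff] using hj)
    exact Finset.mem_image.2 ⟨r, hr, hrj⟩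
  have := (Finset.card_le_card hsub).trans Finset.card_image_le
  simp only [Finset.card_range] at this
  omega

open scoped Classical in
/-- The connected components of `p` in the subsets of `W` that contain `p`. -/
noncomputable def animals {d : ℕ} (W : Finset (Site d)) (p : Site d) : Finset (Finset (Site d)) :=
  (W.powerset.filter fun S => p ∈ S).image fun S => component S p

/-- A uniformly random subset of `W` has component `K` at `p` as soon as it contains `K` and avoids
`boundary K`. This fixes at most `(2 * d + 1) * K.card` sites. -/
theorem pow_card_le_card_component_fiber {d : ℕ} {W S : Finset (Site d)} {p : Site d}
    (hS : S ⊆ W) (hp : p ∈ S) :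
    2 ^ W.card ≤ (W.powerset.filter fun T => component T p = component S p).card *
      2 ^ ((2 * d + 1) * (component S p).card) := by
  set K := component S p with hK
  set R := W \ (K ∪ boundary K) with hR
  have h1 : W.card ≤ R.card + (2 * d + 1) * K.card := by
    have h2 := Finset.le_card_sdiff (K ∪ boundary K) W
    rw [← hR] at h2
    have h3 := Finset.card_union_le K (boundary K)
    have h4 := card_boundary_le K
    have h5 : (2 * d + 1) * K.card = 2 * d * K.card + K.card := by ring
    omega
  have h2 : 2 ^ R.card ≤ (W.powerset.filter fun T => component T p = K).card := by
    rw [← Finset.card_powerset]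
    refine Finset.card_le_card_of_injOn (fun T => K ∪ T) (fun T hT => ?_) ?_
    · rw [Finset.mem_coe, Finset.mem_powerset] at hT
      simp only [Finset.coe_filter, Finset.mem_powerset, Set.mem_ofPred_eq]
      refine ⟨Finset.union_subset ((component_subset _ _).trans hS)
        (hT.trans Finset.sdiff_subset), component_union_eq hp ?_⟩
      refine Finset.disjoint_left.2 fun q hq hqb => ?_
      exact (Finset.mem_sdiff.1 (hT hq)).2 (Finset.mem_union_right _ hqb)
    · intro T hT T' hT' h
      rw [Finset.mem_coe, Finset.mem_powerset] at hT hT'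
      have hd : ∀ T ⊆ R, (K ∪ T) \ K = T := fun T hT => by
        rw [Finset.union_sdiff_left]
        refine Finset.sdiff_eq_self_of_disjoint (Finset.disjoint_left.2 fun q hq hqK => ?_)
        exact (Finset.mem_sdiff.1 (hT hq)).2 (Finset.mem_union_left _ hqK)
      rw [← hd T hT, ← hd T' hT']
      exact congrArg (· \ K) h
  calc 2 ^ W.card ≤ 2 ^ (R.card + (2 * d + 1) * K.card) := Nat.pow_le_pow_right (by norm_num) h1
    _ = 2 ^ R.card * 2 ^ ((2 * d + 1) * K.card) := pow_add _ _ _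
    _ ≤ _ := Nat.mul_le_mul_right _ h2

/-- Each summand is a lower bound for the probability that a uniformly random subset of `W` has
component `K` at `p`, and these events are disjoint for distinct `K`. -/
theorem sum_animals_le_one {d : ℕ} (W : Finset (Site d)) (p : Site d) :
    ∑ K ∈ animals W p, ((1 : ℝ) / 2 ^ ((2 * d + 1) * K.card)) ≤ 1 := by
  classical
  have h2 : (0 : ℝ) < 2 ^ W.card := by positivity
  have key : ∑ K ∈ animals W p, ((2 : ℝ) ^ W.card / 2 ^ ((2 * d + 1) * K.card)) ≤ 2 ^ W.card := by
    calc _ ≤ ∑ K ∈ animals W p,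
          (((W.powerset.filter fun T => component T p = K).card : ℕ) : ℝ) := by
          refine Finset.sum_le_sum fun K hK => ?_
          obtain ⟨S, hS, rfl⟩ := Finset.mem_image.1 hK
          rw [Finset.mem_filter, Finset.mem_powerset] at hS
          rw [div_le_iff₀ (by positivity)]
          exact_mod_cast pow_card_le_card_component_fiber hS.1 hS.2
      _ ≤ 2 ^ W.card := by
          have h := Finset.card_powerset W
          rw [← Nat.cast_sum]
          have h' : ∑ K ∈ animals W p, (W.powerset.filter fun T => component T p = K).card ≤
              W.powerset.card := by
            rw [← Finset.card_biUnion]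
            · exact Finset.card_le_card (Finset.biUnion_subset.2 fun K _ => Finset.filter_subset _ _)
            · intro K _ K' _ hKK'
              refine Finset.disjoint_left.2 fun T hT hT' => hKK' ?_
              rw [← (Finset.mem_filter.1 hT).2, ← (Finset.mem_filter.1 hT').2]
          rw [h] at h'
          exact_mod_cast h'
  have heq : ∑ K ∈ animals W p, ((2 : ℝ) ^ W.card / 2 ^ ((2 * d + 1) * K.card)) =
      2 ^ W.card * ∑ K ∈ animals W p, ((1 : ℝ) / 2 ^ ((2 * d + 1) * K.card)) := by
    rw [Finset.mul_sum]
    exact Finset.sum_congr rfl fun K _ => by ring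
  rw [heq] at key
  exact le_of_mul_le_mul_left (by linarith) h2

/-! ### Admissible points with prescribed values outside a finite set -/

theorem mem_stepShift_iff {g d : ℕ} {x : Point (Fin (g + 1)) d} :
    x ∈ stepShift g d ↔ ∀ p q, Adj p q → (x p : ℕ) ≤ x q + 1 := by
  constructor
  · intro h p q hpq
    obtain ⟨i, hi | hi⟩ := (l1norm_eq_one_iff _).1 hpq
    · have h1 := abs_le.1 (h q i)
      rw [show q + basisVec i = p by rw [← hi]; abel] at h1
      omega
    · have h1 := abs_le.1 (h p i)
      rw [show p + basisVec i = q by rw [← neg_neg (basisVec i), ← hi]; abel] at h1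
      omega
  · intro h p i
    have h1 := h _ _ (adj_add_basisVec p i)
    have h2 := h _ _ (adj_add_basisVec p i).symm
    rw [abs_le]
    constructor <;> omega

theorem finite_fiber {g d : ℕ} (W : Finset (Site d)) (ξ : Point (Fin (g + 1)) d) :
    {x | x ∈ stepShift g d ∧ ∀ p ∉ W, x p = ξ p}.Finite := by
  refine Set.Finite.of_finite_image (f := W.restrict) (Set.toFinite _) ?_
  intro x hx y hy h
  funext p
  by_cases hp : p ∈ W
  · exact congrFun h ⟨p, hp⟩
  · rw [hx.2 p hp, hy.2 p hp]

/-- The points of `stepShift g d` that agree with `ξ` outside `W`. -/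
noncomputable def fiber {g d : ℕ} (W : Finset (Site d)) (ξ : Point (Fin (g + 1)) d) :
    Finset (Point (Fin (g + 1)) d) :=
  (finite_fiber W ξ).toFinset

theorem mem_fiber {g d : ℕ} {W : Finset (Site d)} {ξ x : Point (Fin (g + 1)) d} :
    x ∈ fiber W ξ ↔ x ∈ stepShift g d ∧ ∀ p ∉ W, x p = ξ p := by
  simp [fiber]

theorem self_mem_fiber {g d : ℕ} (W : Finset (Site d)) {ξ : Point (Fin (g + 1)) d}
    (hξ : ξ ∈ stepShift g d) : ξ ∈ fiber W ξ :=
  mem_fiber.2 ⟨hξ, fun _ _ => rfl⟩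

/-- The weight `lam ^ (∑ p ∈ W, x p)`. -/
def wt {g d : ℕ} (lam : ℝ) (W : Finset (Site d)) (x : Point (Fin (g + 1)) d) : ℝ :=
  ∏ p ∈ W, lam ^ (x p : ℕ)

theorem wt_pos {g d : ℕ} {lam : ℝ} (hl : 0 < lam) (W : Finset (Site d))
    (x : Point (Fin (g + 1)) d) : 0 < wt lam W x :=
  Finset.prod_pos fun _ _ => pow_pos hl _

/-- The total weight of `fiber W ξ`. -/
noncomputable def mass {g d : ℕ} (lam : ℝ) (W : Finset (Site d)) (ξ : Point (Fin (g + 1)) d) : ℝ :=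
  ∑ x ∈ fiber W ξ, wt lam W x

theorem mass_pos {g d : ℕ} {lam : ℝ} (hl : 0 < lam) (W : Finset (Site d))
    {ξ : Point (Fin (g + 1)) d} (hξ : ξ ∈ stepShift g d) : 0 < mass lam W ξ :=
  Finset.sum_pos (fun _ _ => wt_pos hl _ _) ⟨ξ, self_mem_fiber W hξ⟩

/-! ### The maximal admissible extension -/

/-- The pointwise maximum of `fiber W ξ`. -/
noncomputable def maxPoint {g d : ℕ} (W : Finset (Site d)) (ξ : Point (Fin (g + 1)) d) :
    Point (Fin (g + 1)) d :=
  fun p => (fiber W ξ).sup fun x => x p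

theorem le_maxPoint {g d : ℕ} {W : Finset (Site d)} {ξ x : Point (Fin (g + 1)) d}
    (hx : x ∈ fiber W ξ) (p : Site d) : x p ≤ maxPoint W ξ p :=
  Finset.le_sup (f := fun x : Point (Fin (g + 1)) d => x p) hx

theorem exists_eq_maxPoint {g d : ℕ} (W : Finset (Site d)) {ξ : Point (Fin (g + 1)) d}
    (hξ : ξ ∈ stepShift g d) (p : Site d) : ∃ x ∈ fiber W ξ, maxPoint W ξ p = x p :=
  Finset.exists_mem_eq_sup _ ⟨ξ, self_mem_fiber W hξ⟩ _

theorem maxPoint_mem_fiber {g d : ℕ} (W : Finset (Site d)) {ξ : Point (Fin (g + 1)) d}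
    (hξ : ξ ∈ stepShift g d) : maxPoint W ξ ∈ fiber W ξ := by
  refine mem_fiber.2 ⟨mem_stepShift_iff.2 fun p q hpq => ?_, fun p hp => ?_⟩
  · obtain ⟨x, hx, h⟩ := exists_eq_maxPoint W hξ p
    have h1 := mem_stepShift_iff.1 (mem_fiber.1 hx).1 p q hpq
    have h2 : (x q : ℕ) ≤ maxPoint W ξ q := le_maxPoint hx q
    rw [h]
    omega
  · obtain ⟨x, hx, h⟩ := exists_eq_maxPoint W hξ p
    rw [h, (mem_fiber.1 hx).2 p hp]

/-- The first maximum is damped near the boundary disagreements until it no longer exceeds the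
second, which gives a competitor in `fiber W ξ₂` that still dominates the first maximum at `q`. -/
theorem maxPoint_le_of_far {g d : ℕ} {W : Finset (Site d)} {ξ₁ ξ₂ : Point (Fin (g + 1)) d}
    (h₁ : ξ₁ ∈ stepShift g d) (h₂ : ξ₂ ∈ stepShift g d) {q : Site d} (hq : q ∈ W)
    (hfar : ∀ r ∈ boundary W, ξ₁ r ≠ ξ₂ r → g ≤ l1norm (q - r)) :
    maxPoint W ξ₁ q ≤ maxPoint W ξ₂ q := by
  classical
  obtain ⟨hM₁, hE₁⟩ := mem_fiber.1 (maxPoint_mem_fiber W h₁)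
  obtain ⟨hM₂, hE₂⟩ := mem_fiber.1 (maxPoint_mem_fiber W h₂)
  rw [mem_stepShift_iff] at hM₁ hM₂
  set M₁ := maxPoint W ξ₁
  set M₂ := maxPoint W ξ₂ with hM₂def
  set D := (boundary W).filter fun r => ξ₁ r ≠ ξ₂ r with hD
  -- The damping `k` is at least `g` on `D`, vanishes at distance `g` from it, and changes by at
  -- most one along edges.
  set k : Site d → ℕ := fun r => D.sup fun s => g - l1norm (r - s) with hk
  have hklip : ∀ p q, Adj p q → k p ≤ k q + 1 := by
    intro p q hpq
    refine Finset.sup_le fun s hs => ?_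
    have h3 := hpq.symm.l1norm_le s
    have h4 : g - l1norm (q - s) ≤ k q := Finset.le_sup (f := fun s => g - l1norm (q - s)) hs
    omega
  set h : Site d → ℕ := fun r => max (M₂ r : ℕ) (min (M₁ r : ℕ) (g - k r)) with hh
  have hhlip : ∀ p q, Adj p q → h p ≤ h q + 1 := by
    intro p q hpq
    have h1 := hklip q p hpq.symm
    have h2 := hM₁ p q hpq
    have h3 := hM₂ p q hpq
    simp only [hh]
    omega
  have hlt : ∀ r, h r < g + 1 := by
    intro r
    have h1 := (M₁ r).2
    have h2 := (M₂ r).2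
    simp only [hh]
    omega
  have hoff : ∀ r ∈ boundary W, h r = ξ₂ r := by
    intro r hr
    have hrW := ((mem_boundary W r).1 hr).1
    simp only [hh]
    rw [hE₁ r hrW, hE₂ r hrW]
    by_cases hne : ξ₁ r = ξ₂ r
    · rw [hne]; omega
    · have hrD : r ∈ D := Finset.mem_filter.2 ⟨hr, hne⟩
      have h4 : g - l1norm (r - r) ≤ k r := Finset.le_sup (f := fun s => g - l1norm (r - s)) hrD
      simp only [sub_self, l1norm_zero] at h4
      omega
  set y : Point (Fin (g + 1)) d := fun r => if r ∈ W then ⟨h r, hlt r⟩ else ξ₂ r with hy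
  have hyW : ∀ r ∈ W, (y r : ℕ) = h r := fun r hr => by simp [hy, hr]
  have hyW' : ∀ r ∉ W, y r = ξ₂ r := fun r hr => by simp [hy, hr]
  have hymem : y ∈ fiber W ξ₂ := by
    refine mem_fiber.2 ⟨mem_stepShift_iff.2 fun p q hpq => ?_, hyW'⟩
    by_cases hp : p ∈ W <;> by_cases hq : q ∈ W
    · rw [hyW p hp, hyW q hq]; exact hhlip p q hpq
    · rw [hyW p hp, hyW' q hq, ← hoff q (mem_boundary_of_adj hp hq hpq)]; exact hhlip p q hpq
    · rw [hyW' p hp, hyW q hq, ← hoff p (mem_boundary_of_adj hq hp hpq.symm)]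
      exact hhlip p q hpq
    · rw [hyW' p hp, hyW' q hq]; exact mem_stepShift_iff.1 h₂ p q hpq
  have hkq : k q = 0 := by
    refine Nat.le_zero.1 (Finset.sup_le fun s hs => ?_)
    obtain ⟨hs1, hs2⟩ := Finset.mem_filter.1 hs
    have := hfar s hs1 hs2
    omega
  have hle : (y q : ℕ) ≤ M₂ q := le_maxPoint hymem q
  rw [hyW q hq] at hle
  simp only [hh, hkq] at hle
  have := (M₁ q).2
  rw [Fin.le_def]
  omega

theorem maxPoint_eq_of_far {g d : ℕ} {W : Finset (Site d)} {ξ₁ ξ₂ : Point (Fin (g + 1)) d}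
    (h₁ : ξ₁ ∈ stepShift g d) (h₂ : ξ₂ ∈ stepShift g d) {q : Site d} (hq : q ∈ W)
    (hfar : ∀ r ∈ boundary W, ξ₁ r ≠ ξ₂ r → g ≤ l1norm (q - r)) :
    maxPoint W ξ₁ q = maxPoint W ξ₂ q :=
  le_antisymm (maxPoint_le_of_far h₁ h₂ hq hfar)
    (maxPoint_le_of_far h₂ h₁ hq fun r hr hne => hfar r hr (Ne.symm hne))

/-! ### The Peierls estimate -/

/-- The sites of `W` at which `x` is not maximal. -/
noncomputable def defects {g d : ℕ} (W : Finset (Site d)) (ξ x : Point (Fin (g + 1)) d) :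
    Finset (Site d) :=
  W.filter fun p => x p < maxPoint W ξ p

theorem defects_subset {g d : ℕ} (W : Finset (Site d)) (ξ x : Point (Fin (g + 1)) d) :
    defects W ξ x ⊆ W :=
  Finset.filter_subset _ _

theorem eq_maxPoint_of_notMem_defects {g d : ℕ} {W : Finset (Site d)}
    {ξ x : Point (Fin (g + 1)) d} (hξ : ξ ∈ stepShift g d) (hx : x ∈ fiber W ξ) {p : Site d}
    (hp : p ∉ defects W ξ x) : x p = maxPoint W ξ p := by
  by_cases hpW : p ∈ W
  · exact le_antisymm (le_maxPoint hx p)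
      (not_lt.1 fun h => hp (Finset.mem_filter.2 ⟨hpW, h⟩))
  · rw [(mem_fiber.1 hx).2 p hpW, (mem_fiber.1 (maxPoint_mem_fiber W hξ)).2 p hpW]

/-- The point `x` with its values on `K` raised by one. -/
def raise {g d : ℕ} (K : Finset (Site d)) (x : Point (Fin (g + 1)) d) : Point (Fin (g + 1)) d :=
  fun p => if p ∈ K then ⟨min (x p + 1) g, by omega⟩ else x p

theorem raise_of_notMem {g d : ℕ} {K : Finset (Site d)} (x : Point (Fin (g + 1)) d) {p : Site d}
    (hp : p ∉ K) : raise K x p = x p := by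
  simp [raise, hp]

/-- At a defect the value is below a maximum that is itself at most `g`, so the cap in `raise` is
inactive. -/
theorem raise_val_of_mem {g d : ℕ} {W K : Finset (Site d)} {ξ x : Point (Fin (g + 1)) d}
    (hK : K ⊆ defects W ξ x) {p : Site d} (hp : p ∈ K) : (raise K x p : ℕ) = x p + 1 := by
  have h1 : (x p : ℕ) < maxPoint W ξ p := (Finset.mem_filter.1 (hK hp)).2
  have h2 := (maxPoint W ξ p).2
  simp only [raise, hp, if_true]
  omega

/-- The only edges at risk lead from `K` to a non-defect. There the neighbour already has its
maximal value, and the raised value is still bounded by the admissible `maxPoint`. -/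
theorem raise_mem_fiber {g d : ℕ} {W K : Finset (Site d)} {ξ x : Point (Fin (g + 1)) d}
    (hξ : ξ ∈ stepShift g d) (hx : x ∈ fiber W ξ) (hK : K ⊆ defects W ξ x)
    (hcl : ∀ p ∈ K, ∀ q ∈ defects W ξ x, Adj p q → q ∈ K) : raise K x ∈ fiber W ξ := by
  have hxs := mem_stepShift_iff.1 (mem_fiber.1 hx).1
  refine mem_fiber.2 ⟨mem_stepShift_iff.2 fun p q hpq => ?_, fun p hp => ?_⟩
  · have h1 := hxs p q hpq
    by_cases hp : p ∈ K <;> by_cases hq : q ∈ K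
    · rw [raise_val_of_mem hK hp, raise_val_of_mem hK hq]; omega
    · rw [raise_val_of_mem hK hp, raise_of_notMem x hq,
        eq_maxPoint_of_notMem_defects hξ hx fun h => hq (hcl p hp q h hpq)]
      have h2 : (x p : ℕ) < maxPoint W ξ p := (Finset.mem_filter.1 (hK hp)).2
      have h3 := mem_stepShift_iff.1 (mem_fiber.1 (maxPoint_mem_fiber W hξ)).1 p q hpq
      omega
    · rw [raise_of_notMem x hp, raise_val_of_mem hK hq]; omega
    · rw [raise_of_notMem x hp, raise_of_notMem x hq]; exact h1
  · rw [raise_of_notMem x fun h => hp (defects_subset _ _ _ (hK h)), (mem_fiber.1 hx).2 p hp]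

theorem wt_raise {g d : ℕ} (lam : ℝ) {W K : Finset (Site d)} {ξ x : Point (Fin (g + 1)) d}
    (hK : K ⊆ defects W ξ x) : wt lam W (raise K x) = lam ^ K.card * wt lam W x := by
  have hKW : K ⊆ W := hK.trans (defects_subset _ _ _)
  unfold wt
  rw [← Finset.prod_sdiff hKW, ← Finset.prod_sdiff hKW, mul_left_comm]
  congr 1
  · refine Finset.prod_congr rfl fun p hp => ?_
    rw [raise_of_notMem x (Finset.mem_sdiff.1 hp).2]
  · rw [← Finset.prod_const, ← Finset.prod_mul_distrib]
    refine Finset.prod_congr rfl fun p hp => ?_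
    rw [raise_val_of_mem hK hp, pow_succ']

theorem raise_injOn {g d : ℕ} {W K : Finset (Site d)} {ξ x y : Point (Fin (g + 1)) d}
    (hx : K ⊆ defects W ξ x) (hy : K ⊆ defects W ξ y) (h : raise K x = raise K y) : x = y := by
  funext p
  have hp' := congrFun h p
  by_cases hp : p ∈ K
  · have h1 := congrArg Fin.val hp'
    rw [raise_val_of_mem hx hp, raise_val_of_mem hy hp] at h1
    exact Fin.ext (by omega)
  · rwa [raise_of_notMem x hp, raise_of_notMem y hp] at hp'

theorem mass_mul_mass {g d : ℕ} (lam : ℝ) (W : Finset (Site d)) (ξ₁ ξ₂ : Point (Fin (g + 1)) d) :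
    mass lam W ξ₁ * mass lam W ξ₂ =
      ∑ x ∈ fiber W ξ₁ ×ˢ fiber W ξ₂, wt lam W x.1 * wt lam W x.2 := by
  rw [mass, mass, Finset.sum_mul_sum, Finset.sum_product]

/-- The component of `p` in the set of sites at which one of two points is not maximal. -/
noncomputable def defectComponent {g d : ℕ} (W : Finset (Site d)) (ξ₁ ξ₂ : Point (Fin (g + 1)) d)
    (p : Site d) (x : Point (Fin (g + 1)) d × Point (Fin (g + 1)) d) : Finset (Site d) :=
  component (defects W ξ₁ x.1 ∪ defects W ξ₂ x.2) p

-- Peierls estimate for a prescribed component. Once the traces `K₁`, `K₂` of the two defect sets on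
-- `K` are fixed, raising each configuration on its trace is injective and gains at least `lam ^
-- K.card`, because `K = K₁ ∪ K₂`. There are at most `4 ^ K.card` pairs of traces.
open scoped Classical in
theorem sum_defectComponent_eq_le {g d : ℕ} {lam : ℝ} (hl : 1 ≤ lam) {W : Finset (Site d)}
    {ξ₁ ξ₂ : Point (Fin (g + 1)) d} (h₁ : ξ₁ ∈ stepShift g d) (h₂ : ξ₂ ∈ stepShift g d)
    (p : Site d) (K : Finset (Site d)) :
    ∑ x ∈ (fiber W ξ₁ ×ˢ fiber W ξ₂).filter (fun x => defectComponent W ξ₁ ξ₂ p x = K),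
        wt lam W x.1 * wt lam W x.2 ≤
      (4 / lam) ^ K.card * (mass lam W ξ₁ * mass lam W ξ₂) := by
  have hl0 : 0 < lam := by linarith
  set F := (fiber W ξ₁ ×ˢ fiber W ξ₂).filter (fun x => defectComponent W ξ₁ ξ₂ p x = K) with hF
  set c : Point (Fin (g + 1)) d × Point (Fin (g + 1)) d → Finset (Site d) × Finset (Site d) :=
    fun x => (K ∩ defects W ξ₁ x.1, K ∩ defects W ξ₂ x.2) with hc
  have hmaps : ∀ x ∈ F, c x ∈ K.powerset ×ˢ K.powerset := fun x _ => by
    simp [hc, Finset.inter_subset_left]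
  have hclosed : ∀ x ∈ F, ∀ q ∈ K, ∀ r ∈ defects W ξ₁ x.1 ∪ defects W ξ₂ x.2, Adj q r → r ∈ K := by
    intro x hx q hq r hr hqr
    have hK := (Finset.mem_filter.1 hx).2
    rw [← hK] at hq ⊢
    exact mem_component_of_adj hq hr hqr
  rw [← Finset.sum_fiberwise_of_maps_to hmaps]
  have hinner : ∀ k ∈ K.powerset ×ˢ K.powerset,
      ∑ x ∈ F.filter (fun x => c x = k), wt lam W x.1 * wt lam W x.2 ≤
        (1 / lam) ^ K.card * (mass lam W ξ₁ * mass lam W ξ₂) := by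
    rintro ⟨K₁, K₂⟩ _
    have hdata : ∀ x ∈ F.filter (fun x => c x = (K₁, K₂)),
        x.1 ∈ fiber W ξ₁ ∧ x.2 ∈ fiber W ξ₂ ∧ K₁ ⊆ defects W ξ₁ x.1 ∧ K₂ ⊆ defects W ξ₂ x.2 ∧
        raise K₁ x.1 ∈ fiber W ξ₁ ∧ raise K₂ x.2 ∈ fiber W ξ₂ ∧ K = K₁ ∪ K₂ := by
      intro x hx
      obtain ⟨hxF, hxc⟩ := Finset.mem_filter.1 hx
      obtain ⟨hxp, hxK⟩ := Finset.mem_filter.1 hxF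
      obtain ⟨hx1, hx2⟩ := Finset.mem_product.1 hxp
      obtain ⟨rfl, rfl⟩ := Prod.mk_inj.1 hxc
      refine ⟨hx1, hx2, Finset.inter_subset_right, Finset.inter_subset_right,
        raise_mem_fiber h₁ hx1 Finset.inter_subset_right fun q hq r hr hqr => ?_,
        raise_mem_fiber h₂ hx2 Finset.inter_subset_right fun q hq r hr hqr => ?_, ?_⟩
      · exact Finset.mem_inter.2 ⟨hclosed x hxF q (Finset.mem_inter.1 hq).1 r
          (Finset.mem_union_left _ hr) hqr, hr⟩
      · exact Finset.mem_inter.2 ⟨hclosed x hxF q (Finset.mem_inter.1 hq).1 r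
          (Finset.mem_union_right _ hr) hqr, hr⟩
      · rw [← Finset.inter_union_distrib_left, Finset.inter_eq_left.2]
        rw [← hxK]
        exact component_subset _ _
    rw [one_div, inv_pow, inv_mul_eq_div, le_div_iff₀ (by positivity), Finset.sum_mul,
      mass_mul_mass]
    calc ∑ x ∈ F.filter (fun x => c x = (K₁, K₂)), wt lam W x.1 * wt lam W x.2 * lam ^ K.card
        ≤ ∑ x ∈ F.filter (fun x => c x = (K₁, K₂)),
            wt lam W (raise K₁ x.1) * wt lam W (raise K₂ x.2) := by
          refine Finset.sum_le_sum fun x hx => ?_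
          obtain ⟨-, -, hd1, hd2, -, -, hK⟩ := hdata x hx
          rw [wt_raise lam hd1, wt_raise lam hd2]
          have h3 : lam ^ K.card ≤ lam ^ K₁.card * lam ^ K₂.card := by
            rw [← pow_add, hK]
            exact pow_le_pow_right₀ hl (Finset.card_union_le _ _)
          have h4 := mul_pos (wt_pos hl0 W x.1) (wt_pos hl0 W x.2)
          calc _ ≤ wt lam W x.1 * wt lam W x.2 * (lam ^ K₁.card * lam ^ K₂.card) :=
                mul_le_mul_of_nonneg_left h3 h4.le
            _ = _ := by ring
      _ = ∑ y ∈ (F.filter (fun x => c x = (K₁, K₂))).image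
            (fun x => (raise K₁ x.1, raise K₂ x.2)), wt lam W y.1 * wt lam W y.2 := by
          rw [Finset.sum_image]
          intro x hx y hy hxy
          obtain ⟨-, -, hd1, hd2, -, -, -⟩ := hdata x hx
          obtain ⟨-, -, hd1', hd2', -, -, -⟩ := hdata y hy
          obtain ⟨e1, e2⟩ := Prod.mk_inj.1 hxy
          exact Prod.ext (raise_injOn hd1 hd1' e1) (raise_injOn hd2 hd2' e2)
      _ ≤ _ := by
          refine Finset.sum_le_sum_of_subset_of_nonneg ?_ fun y _ _ =>
            (mul_pos (wt_pos hl0 W y.1) (wt_pos hl0 W y.2)).le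
          intro y hy
          obtain ⟨x, hx, rfl⟩ := Finset.mem_image.1 hy
          obtain ⟨-, -, -, -, hm1, hm2, -⟩ := hdata x hx
          exact Finset.mem_product.2 ⟨hm1, hm2⟩
  refine (Finset.sum_le_sum hinner).trans (le_of_eq ?_)
  rw [Finset.sum_const, Finset.card_product, Finset.card_powerset, nsmul_eq_mul, ← mul_assoc]
  push_cast
  rw [← mul_pow, ← mul_pow, mul_one_div, show (2 : ℝ) * 2 = 4 by norm_num]

-- Since `2 ^ (2 * d + 3) = 4 * 2 ^ (2 * d + 1)`, the factor `(4 / lam) ^ K.card` splits into a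
-- power that is at most its `m`-th power and the weight summed in `sum_animals_le_one`.
open scoped Classical in
theorem sum_le_card_defectComponent_le {g d : ℕ} {lam : ℝ} (hl : 2 ^ (2 * d + 3) ≤ lam)
    {W : Finset (Site d)} {ξ₁ ξ₂ : Point (Fin (g + 1)) d} (h₁ : ξ₁ ∈ stepShift g d)
    (h₂ : ξ₂ ∈ stepShift g d) (p : Site d) {m : ℕ} (hm : 0 < m) :
    ∑ x ∈ (fiber W ξ₁ ×ˢ fiber W ξ₂).filter
        (fun x => m ≤ (defectComponent W ξ₁ ξ₂ p x).card), wt lam W x.1 * wt lam W x.2 ≤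
      (2 ^ (2 * d + 3) / lam) ^ m * (mass lam W ξ₁ * mass lam W ξ₂) := by
  have hl1 : 1 ≤ lam := (one_le_pow₀ (by norm_num)).trans hl
  have hl0 : 0 < lam := by linarith
  set F := (fiber W ξ₁ ×ˢ fiber W ξ₂).filter
    (fun x => m ≤ (defectComponent W ξ₁ ξ₂ p x).card) with hF
  have hmaps : ∀ x ∈ F, defectComponent W ξ₁ ξ₂ p x ∈
      (animals W p).filter fun K => m ≤ K.card := by
    intro x hx
    have hx' := (Finset.mem_filter.1 hx).2
    refine Finset.mem_filter.2 ⟨Finset.mem_image.2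
      ⟨defects W ξ₁ x.1 ∪ defects W ξ₂ x.2, Finset.mem_filter.2 ⟨?_, ?_⟩, rfl⟩, hx'⟩
    · exact Finset.mem_powerset.2
        (Finset.union_subset (defects_subset _ _ _) (defects_subset _ _ _))
    · obtain ⟨q, hq⟩ := Finset.card_pos.1 (hm.trans_le hx')
      exact mem_of_mem_component hq
  have hM : 0 ≤ mass lam W ξ₁ * mass lam W ξ₂ :=
    (mul_pos (mass_pos hl0 W h₁) (mass_pos hl0 W h₂)).le
  have hr0 : (0 : ℝ) ≤ 2 ^ (2 * d + 3) / lam := by positivity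
  have hr1 : 2 ^ (2 * d + 3) / lam ≤ 1 := (div_le_one hl0).2 hl
  rw [← Finset.sum_fiberwise_of_maps_to hmaps]
  calc _ ≤ ∑ K ∈ (animals W p).filter (fun K => m ≤ K.card),
        (2 ^ (2 * d + 3) / lam) ^ m * (mass lam W ξ₁ * mass lam W ξ₂) *
          (1 / 2 ^ ((2 * d + 1) * K.card)) := by
        refine Finset.sum_le_sum fun K hK => ?_
        have hmK := (Finset.mem_filter.1 hK).2
        calc _ ≤ ∑ x ∈ (fiber W ξ₁ ×ˢ fiber W ξ₂).filter
              (fun x => defectComponent W ξ₁ ξ₂ p x = K), wt lam W x.1 * wt lam W x.2 := by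
              refine Finset.sum_le_sum_of_subset_of_nonneg ?_ fun y _ _ =>
                (mul_pos (wt_pos hl0 W y.1) (wt_pos hl0 W y.2)).le
              rw [hF, Finset.filter_filter]
              exact Finset.monotone_filter_right _ fun x _ hx => hx.2
          _ ≤ (4 / lam) ^ K.card * (mass lam W ξ₁ * mass lam W ξ₂) :=
              sum_defectComponent_eq_le hl1 h₁ h₂ p K
          _ = (2 ^ (2 * d + 3) / lam) ^ K.card * (mass lam W ξ₁ * mass lam W ξ₂) *
                (1 / 2 ^ ((2 * d + 1) * K.card)) := by
              rw [pow_mul, show (4 : ℝ) / lam = 2 ^ (2 * d + 3) / lam / 2 ^ (2 * d + 1) by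
                field_simp; ring, div_pow _ (2 ^ (2 * d + 1))]
              ring
          _ ≤ _ := by
              gcongr ?_ * _ * _
              exact pow_le_pow_of_le_one hr0 hr1 hmK
    _ = (2 ^ (2 * d + 3) / lam) ^ m * (mass lam W ξ₁ * mass lam W ξ₂) *
          ∑ K ∈ (animals W p).filter (fun K => m ≤ K.card),
            (1 / 2 ^ ((2 * d + 1) * K.card) : ℝ) := by rw [Finset.mul_sum]
    _ ≤ (2 ^ (2 * d + 3) / lam) ^ m * (mass lam W ξ₁ * mass lam W ξ₂) * 1 := by
        refine mul_le_mul_of_nonneg_left ?_ (mul_nonneg (pow_nonneg hr0 _) hM)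
        refine (Finset.sum_le_sum_of_subset_of_nonneg (Finset.filter_subset _ _)
          fun K _ _ => by positivity).trans (sum_animals_le_one W p)
    _ = _ := mul_one _

theorem sum_biUnion_le_sum {ι κ : Type*} [DecidableEq κ] {U : Finset ι} {t : ι → Finset κ}
    {f : κ → ℝ} (hf : ∀ x ∈ U.biUnion t, 0 ≤ f x) :
    ∑ x ∈ U.biUnion t, f x ≤ ∑ p ∈ U, ∑ x ∈ t p, f x := by
  classical
  induction U using Finset.induction_on with
  | empty => simp
  | insert a U ha ih =>
    rw [Finset.biUnion_insert] at hf ⊢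
    rw [Finset.sum_insert ha]
    have h1 := Finset.sum_union_inter (s₁ := t a) (s₂ := U.biUnion t) (f := f)
    have h2 : 0 ≤ ∑ x ∈ t a ∩ U.biUnion t, f x := Finset.sum_nonneg fun x hx =>
      hf x (Finset.mem_union_left _ (Finset.mem_inter.1 hx).1)
    have h3 := ih fun x hx => hf x (Finset.mem_union_right _ hx)
    linarith

/-! ### Finite-volume probabilities and the swapping argument -/

open scoped Classical in
/-- The probability of `E` under the finite-volume Gibbs distribution on `fiber W ξ`. -/
noncomputable def prob {g d : ℕ} (lam : ℝ) (W : Finset (Site d)) (ξ : Point (Fin (g + 1)) d)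
    (E : Set (Point (Fin (g + 1)) d)) : ℝ :=
  (∑ x ∈ fiber W ξ with x ∈ E, wt lam W x) / mass lam W ξ

/-- The sites of `W ∪ ∂W` at which two points differ. -/
def differ {g d : ℕ} (W : Finset (Site d))
    (x : Point (Fin (g + 1)) d × Point (Fin (g + 1)) d) : Finset (Site d) :=
  -- Boundary sites are included so that a cluster reaching a boundary disagreement is detected as
  -- leaving `W`.
  (W ∪ boundary W).filter fun p => x.1 p ≠ x.2 p

/-- The sites connected to `U` by sites at which two points differ. -/
noncomputable def differCluster {g d : ℕ} (W U : Finset (Site d))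
    (x : Point (Fin (g + 1)) d × Point (Fin (g + 1)) d) : Finset (Site d) :=
  U.biUnion fun p => component (differ W x) p

/-- Exchange the values of two points on `C`. -/
def exchange {g d : ℕ} (C : Finset (Site d))
    (x : Point (Fin (g + 1)) d × Point (Fin (g + 1)) d) :
    Point (Fin (g + 1)) d × Point (Fin (g + 1)) d :=
  (fun p => if p ∈ C then x.2 p else x.1 p, fun p => if p ∈ C then x.1 p else x.2 p)

/-! ### Exchanging two configurations on a disagreement cluster. -/

section exchange

variable {g d : ℕ} {W U C : Finset (Site d)} {ξ₁ ξ₂ : Point (Fin (g + 1)) d}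
  {x : Point (Fin (g + 1)) d × Point (Fin (g + 1)) d}

theorem exchange_exchange (C : Finset (Site d))
    (x : Point (Fin (g + 1)) d × Point (Fin (g + 1)) d) : exchange C (exchange C x) = x := by
  refine Prod.ext (funext fun p => ?_) (funext fun p => ?_) <;>
    by_cases hp : p ∈ C <;> simp [exchange, hp]

theorem differ_exchange (C : Finset (Site d)) : differ W (exchange C x) = differ W x := by
  refine Finset.filter_congr fun p _ => ?_
  by_cases hp : p ∈ C <;> simp [exchange, hp, ne_comm]

theorem wt_exchange (lam : ℝ) (W C : Finset (Site d))
    (x : Point (Fin (g + 1)) d × Point (Fin (g + 1)) d) :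
    wt lam W (exchange C x).1 * wt lam W (exchange C x).2 = wt lam W x.1 * wt lam W x.2 := by
  unfold wt
  rw [← Finset.prod_mul_distrib, ← Finset.prod_mul_distrib]
  refine Finset.prod_congr rfl fun p _ => ?_
  by_cases hp : p ∈ C <;> simp [exchange, hp, mul_comm]

theorem eq_of_adj_differCluster {p q : Site d} (hC : differCluster W U x ⊆ W)
    (hp : p ∈ differCluster W U x) (hq : q ∉ differCluster W U x) (hpq : Adj p q) :
    x.1 q = x.2 q := by
  by_contra hne
  obtain ⟨s, hs, hps⟩ := Finset.mem_biUnion.1 hp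
  have hqW : q ∈ W ∪ boundary W := by
    by_cases h : q ∈ W
    · exact Finset.mem_union_left _ h
    · exact Finset.mem_union_right _ (mem_boundary_of_adj (hC hp) h hpq)
  exact hq (Finset.mem_biUnion.2
    ⟨s, hs, mem_component_of_adj hps (Finset.mem_filter.2 ⟨hqW, hne⟩) hpq⟩)

/-- The two points agree on the sites bordering the cluster, so across its edge each exchanged point
looks like one of the originals. -/
theorem exchange_mem (hC : differCluster W U x ⊆ W) (hx : x ∈ fiber W ξ₁ ×ˢ fiber W ξ₂) :
    exchange (differCluster W U x) x ∈ fiber W ξ₁ ×ˢ fiber W ξ₂ := by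
  obtain ⟨hx1, hx2⟩ := Finset.mem_product.1 hx
  rw [mem_fiber, mem_stepShift_iff] at hx1 hx2
  rw [Finset.mem_product, mem_fiber, mem_fiber, mem_stepShift_iff, mem_stepShift_iff]
  have hoff : ∀ p ∉ W, p ∉ differCluster W U x := fun p hp h => hp (hC h)
  refine ⟨⟨fun p q hpq => ?_, fun p hp => ?_⟩, ⟨fun p q hpq => ?_, fun p hp => ?_⟩⟩
  · have h1 := hx1.1 p q hpq
    have h2 := hx2.1 p q hpq
    by_cases hp : p ∈ differCluster W U x <;> by_cases hq : q ∈ differCluster W U x <;>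
      simp only [exchange, hp, hq, if_true, if_false]
    · exact h2
    · rw [eq_of_adj_differCluster hC hp hq hpq]; exact h2
    · rw [eq_of_adj_differCluster hC hq hp hpq.symm]; exact h2
    · exact h1
  · simp only [exchange, hoff p hp, if_false]
    exact hx1.2 p hp
  · have h1 := hx1.1 p q hpq
    have h2 := hx2.1 p q hpq
    by_cases hp : p ∈ differCluster W U x <;> by_cases hq : q ∈ differCluster W U x <;>
      simp only [exchange, hp, hq, if_true, if_false]
    · exact h1
    · rw [← eq_of_adj_differCluster hC hp hq hpq]; exact h1
    · rw [← eq_of_adj_differCluster hC hq hp hpq.symm]; exact h1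
    · exact h2
  · simp only [exchange, hoff p hp, if_false]
    exact hx2.2 p hp

theorem eq_of_notMem_differCluster (hU : U ⊆ W) {p : Site d} (hp : p ∈ U)
    (h : p ∉ differCluster W U x) : x.1 p = x.2 p := by
  by_contra hne
  exact h (Finset.mem_biUnion.2 ⟨p, hp, self_mem_component
    (Finset.mem_filter.2 ⟨Finset.mem_union_left _ (hU hp), hne⟩)⟩)

theorem exchange_fst (hU : U ⊆ W) {p : Site d} (hp : p ∈ U) :
    (exchange (differCluster W U x) x).1 p = x.2 p := by
  by_cases h : p ∈ differCluster W U x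
  · simp [exchange, h]
  · simp [exchange, h, eq_of_notMem_differCluster hU hp h]

theorem exchange_snd (hU : U ⊆ W) {p : Site d} (hp : p ∈ U) :
    (exchange (differCluster W U x) x).2 p = x.1 p := by
  by_cases h : p ∈ differCluster W U x
  · simp [exchange, h]
  · simp [exchange, h, eq_of_notMem_differCluster hU hp h]

/-- A disagreement cluster that leaves `W` forces a large cluster of defects. -/
theorem le_card_defectComponent (h₁ : ξ₁ ∈ stepShift g d) (h₂ : ξ₂ ∈ stepShift g d)
    (hx : x ∈ fiber W ξ₁ ×ˢ fiber W ξ₂) {p : Site d} {m : ℕ}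
    (hfar : ∀ r ∈ boundary W, ξ₁ r ≠ ξ₂ r → m + g ≤ l1norm (p - r))
    (hleave : ¬ component (differ W x) p ⊆ W) :
    m ≤ (defectComponent W ξ₁ ξ₂ p x).card := by
  obtain ⟨hx1, hx2⟩ := Finset.mem_product.1 hx
  by_contra! hlt
  -- Distance `g` already makes the two maxima equal; the extra one excludes boundary disagreements
  -- themselves, also when `g = 0`.
  have hdef : ∀ q ∈ differ W x, (∀ r ∈ boundary W, ξ₁ r ≠ ξ₂ r → g + 1 ≤ l1norm (q - r)) →
      q ∈ defects W ξ₁ x.1 ∪ defects W ξ₂ x.2 := by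
    intro q hq hqfar
    obtain ⟨hqW, hne⟩ := Finset.mem_filter.1 hq
    have hqW' : q ∈ W := by
      rcases Finset.mem_union.1 hqW with h | h
      · exact h
      · have hqn := ((mem_boundary W q).1 h).1
        rw [(mem_fiber.1 hx1).2 q hqn, (mem_fiber.1 hx2).2 q hqn] at hne
        have := hqfar q h hne
        simp at this
    by_contra hnot
    rw [Finset.mem_union, not_or] at hnot
    apply hne
    rw [eq_maxPoint_of_notMem_defects h₁ hx1 hnot.1, eq_maxPoint_of_notMem_defects h₂ hx2 hnot.2]
    exact maxPoint_eq_of_far h₁ h₂ hqW' fun r hr hrne => (Nat.le_succ g).trans (hqfar r hr hrne)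
  refine hleave fun q hq => ?_
  suffices h : q ∈ defectComponent W ξ₁ ξ₂ p x from
    Finset.union_subset (defects_subset _ _ _) (defects_subset _ _ _) (component_subset _ _ h)
  revert q
  refine component_induction (fun hp => self_mem_component (hdef p hp fun r hr hne => ?_))
    fun q _ r hr hqr ih => ?_
  · have := hfar r hr hne
    omega
  -- A defect component with fewer than `m` sites keeps `q` within distance `m - 2` of `p`, so its
  -- neighbour `r` is still at distance at least `g + 1` from every boundary disagreement.
  · refine mem_component_of_adj ih (hdef r (component_subset _ _ hr) fun s hs hne => ?_) hqr
    have e1 := hfar s hs hne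
    have e2 : l1norm (q - p) < (defectComponent W ξ₁ ξ₂ p x).card := l1norm_lt_card_component ih
    have e3 := hqr.symm.l1norm_le p
    have e4 := l1norm_sub_le p r s
    rw [l1norm_sub_comm p r] at e4
    omega

end exchange

-- The difference of probabilities is an expectation over independent pairs. Pairs whose cluster
-- stays in `W` cancel under the exchange; the others have a defect component of at least `m` sites
-- at some point of `U`, and a union bound gives the factor `U.card`.
open scoped Classical in
theorem abs_prob_sub_prob_le {g d : ℕ} {lam : ℝ} (hl : 2 ^ (2 * d + 3) ≤ lam)
    {W U : Finset (Site d)} (hU : U ⊆ W) {ξ₁ ξ₂ : Point (Fin (g + 1)) d}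
    (h₁ : ξ₁ ∈ stepShift g d) (h₂ : ξ₂ ∈ stepShift g d) {m : ℕ} (hm : 0 < m)
    (hfar : ∀ p ∈ U, ∀ r ∈ boundary W, ξ₁ r ≠ ξ₂ r → m + g ≤ l1norm (p - r))
    {E : Set (Point (Fin (g + 1)) d)}
    (hE : ∀ x y : Point (Fin (g + 1)) d, (∀ p ∈ U, x p = y p) → (x ∈ E ↔ y ∈ E)) :
    |prob lam W ξ₁ E - prob lam W ξ₂ E| ≤ U.card * (2 ^ (2 * d + 3) / lam) ^ m := by
  have hl1 : 1 ≤ lam := (one_le_pow₀ (by norm_num)).trans hl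
  have hl0 : 0 < lam := by linarith
  have hM₁ := mass_pos hl0 W h₁
  have hM₂ := mass_pos hl0 W h₂
  set Ω := fiber W ξ₁ ×ˢ fiber W ξ₂ with hΩ
  set ww : Point (Fin (g + 1)) d × Point (Fin (g + 1)) d → ℝ :=
    fun x => wt lam W x.1 * wt lam W x.2 with hww
  have hww0 : ∀ x, 0 ≤ ww x := fun x => (mul_pos (wt_pos hl0 W x.1) (wt_pos hl0 W x.2)).le
  set ind : Point (Fin (g + 1)) d → ℝ := fun x => if x ∈ E then 1 else 0 with hind
  have hindE : ∀ x y : Point (Fin (g + 1)) d, (∀ p ∈ U, x p = y p) → ind x = ind y :=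
    fun x y hxy => by simp only [hind, hE x y hxy]
  set f : Point (Fin (g + 1)) d × Point (Fin (g + 1)) d → ℝ :=
    fun x => ww x * (ind x.1 - ind x.2) with hf
  have hsplit : (prob lam W ξ₁ E - prob lam W ξ₂ E) * (mass lam W ξ₁ * mass lam W ξ₂) =
      ∑ x ∈ Ω, f x := by
    have e1 : ∑ x ∈ Ω, ww x * ind x.1 =
        (∑ x ∈ fiber W ξ₁ with x ∈ E, wt lam W x) * mass lam W ξ₂ := by
      rw [mass, Finset.sum_filter, Finset.sum_mul_sum, Finset.sum_product]
      refine Finset.sum_congr rfl fun x _ => Finset.sum_congr rfl fun y _ => ?_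
      simp only [hww, hind]
      split_ifs <;> ring
    have e2 : ∑ x ∈ Ω, ww x * ind x.2 =
        mass lam W ξ₁ * (∑ x ∈ fiber W ξ₂ with x ∈ E, wt lam W x) := by
      rw [mass, Finset.sum_filter, Finset.sum_mul_sum, Finset.sum_product]
      refine Finset.sum_congr rfl fun x _ => Finset.sum_congr rfl fun y _ => ?_
      simp only [hww, hind]
      split_ifs <;> ring
    simp only [hf, mul_sub, Finset.sum_sub_distrib]
    rw [e1, e2, prob, prob]
    field_simp
  set G := Ω.filter fun x => differCluster W U x ⊆ W with hG
  set B := Ω.filter fun x => ¬ differCluster W U x ⊆ W with hB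
  have hGzero : ∑ x ∈ G, f x = 0 := by
    set τ : Point (Fin (g + 1)) d × Point (Fin (g + 1)) d →
      Point (Fin (g + 1)) d × Point (Fin (g + 1)) d :=
        fun x => exchange (differCluster W U x) x with hτ
    -- Exchanging does not move the sites of disagreement, so the cluster is unchanged and `τ` is an
    -- involution.
    have hclτ : ∀ x, differCluster W U (τ x) = differCluster W U x := fun x => by
      simp only [hτ, differCluster, differ_exchange]
    have hττ : ∀ x, τ (τ x) = x := fun x => by
      change exchange (differCluster W U (τ x)) (τ x) = x
      rw [hclτ]
      exact exchange_exchange _ _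
    have hτG : ∀ x ∈ G, τ x ∈ G := fun x hx => by
      obtain ⟨hxΩ, hxC⟩ := Finset.mem_filter.1 hx
      exact Finset.mem_filter.2 ⟨exchange_mem hxC hxΩ, by rw [hclτ]; exact hxC⟩
    have hneg : ∑ x ∈ G, f x = ∑ x ∈ G, -f x := by
      refine Finset.sum_nbij' τ τ hτG hτG (fun x _ => hττ x) (fun x _ => hττ x) fun x _ => ?_
      have e0 : ww (τ x) = ww x := wt_exchange lam W _ x
      have e1 : ind (τ x).1 = ind x.2 := hindE _ _ fun p hp => exchange_fst hU hp
      have e2 : ind (τ x).2 = ind x.1 := hindE _ _ fun p hp => exchange_snd hU hp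
      simp only [hf, e0, e1, e2]
      ring
    rw [Finset.sum_neg_distrib] at hneg
    linarith
  have hBle : |∑ x ∈ B, f x| ≤ U.card * ((2 ^ (2 * d + 3) / lam) ^ m *
      (mass lam W ξ₁ * mass lam W ξ₂)) := by
    calc |∑ x ∈ B, f x| ≤ ∑ x ∈ B, |f x| := Finset.abs_sum_le_sum_abs _ _
      _ ≤ ∑ x ∈ B, ww x := by
          refine Finset.sum_le_sum fun x _ => ?_
          rw [hf, abs_mul, abs_of_nonneg (hww0 x)]
          refine mul_le_of_le_one_right (hww0 x) ?_
          simp only [hind]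
          split_ifs <;> norm_num
      _ ≤ ∑ x ∈ U.biUnion (fun p =>
            Ω.filter fun x => m ≤ (defectComponent W ξ₁ ξ₂ p x).card), ww x := by
          refine Finset.sum_le_sum_of_subset_of_nonneg (fun x hx => ?_) fun x _ _ => hww0 x
          obtain ⟨hxΩ, hxC⟩ := Finset.mem_filter.1 hx
          rw [differCluster, Finset.biUnion_subset] at hxC
          push Not at hxC
          obtain ⟨p, hp, hpC⟩ := hxC
          exact Finset.mem_biUnion.2 ⟨p, hp, Finset.mem_filter.2
            ⟨hxΩ, le_card_defectComponent h₁ h₂ hxΩ (hfar p hp) hpC⟩⟩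
      _ ≤ ∑ p ∈ U, ∑ x ∈ Ω.filter (fun x => m ≤ (defectComponent W ξ₁ ξ₂ p x).card), ww x :=
          sum_biUnion_le_sum fun x _ => hww0 x
      _ ≤ ∑ _p ∈ U, (2 ^ (2 * d + 3) / lam) ^ m * (mass lam W ξ₁ * mass lam W ξ₂) :=
          Finset.sum_le_sum fun p _ => sum_le_card_defectComponent_le hl h₁ h₂ p hm
      _ = _ := by rw [Finset.sum_const, nsmul_eq_mul]
  rw [← Finset.sum_filter_add_sum_filter_not Ω (fun x => differCluster W U x ⊆ W), hGzero,
    zero_add] at hsplit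
  have hMM := mul_pos hM₁ hM₂
  rw [← mul_le_mul_iff_left₀ hMM, mul_assoc]
  calc _ = |(prob lam W ξ₁ E - prob lam W ξ₂ E) * (mass lam W ξ₁ * mass lam W ξ₂)| := by
        rw [abs_mul, abs_of_pos hMM]
    _ ≤ _ := by rw [hsplit]; exact hBle

/-! ### Cylinder sets -/

theorem mem_cyl_restrict {A : Type*} {d : ℕ} {V : Finset (Site d)} {x z : Point A d} :
    z ∈ cyl (V.restrict x) ↔ ∀ p ∈ V, z p = x p := by
  simp only [cyl, Set.mem_ofPred_eq, funext_iff, Finset.restrict, Subtype.forall]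

theorem isClopen_cyl {g d : ℕ} {V : Finset (Site d)} (u : Config (Fin (g + 1)) V) :
    IsClopen (cyl u) := by
  have hc : Continuous (V.restrict : Point (Fin (g + 1)) d → Config (Fin (g + 1)) V) := by
    unfold Finset.restrict
    fun_prop
  exact (isClopen_discrete {u}).preimage hc

theorem measurableSet_cyl {g d : ℕ} {V : Finset (Site d)} (u : Config (Fin (g + 1)) V) :
    MeasurableSet (cyl u) :=
  (isClopen_cyl u).isOpen.measurableSet

theorem sum_real_inter_cyl {g d : ℕ} (μ : Measure (Point (Fin (g + 1)) d)) [IsFiniteMeasure μ]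
    (V : Finset (Site d)) {E : Set (Point (Fin (g + 1)) d)} (hE : MeasurableSet E) :
    ∑ δ : Config (Fin (g + 1)) V, μ.real (E ∩ cyl δ) = μ.real E := by
  rw [← measureReal_iUnion_fintype]
  · congr 1
    ext x
    simp only [Set.mem_iUnion, Set.mem_inter_iff]
    exact ⟨fun ⟨_, h, _⟩ => h, fun h => ⟨V.restrict x, h, rfl⟩⟩
  · intro δ δ' hne
    refine Set.disjoint_left.2 fun x hx hx' => hne ?_
    exact hx.2.symm.trans hx'.2
  · exact fun δ => hE.inter (measurableSet_cyl δ)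

/-! ### Gibbs measures in point form -/

/-- A probability measure concentrated on `stepShift g d` whose conditional probabilities inside
finite sets are proportional to the weights `wt`. -/
structure IsDLR {g d : ℕ} (lam : ℝ) (μ : Measure (Point (Fin (g + 1)) d)) : Prop where
  isProbabilityMeasure : IsProbabilityMeasure μ
  measure_compl : μ (stepShift g d)ᶜ = 0
  -- The identity is free of division: it makes sense for null cylinders and passes to limits.
  ratio : ∀ (S T : Finset (Site d)), boundary S ⊆ T → Disjoint T S →
    ∀ (ξ : Point (Fin (g + 1)) d), ∀ x ∈ fiber S ξ, ∀ y ∈ fiber S ξ,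
      wt lam S y * μ.real (cyl ((S ∪ T).restrict x)) =
        wt lam S x * μ.real (cyl ((S ∪ T).restrict y))

/-- The point that agrees with `x` on `S` and with `z` elsewhere. -/
def glue {g d : ℕ} (S : Finset (Site d)) (x z : Point (Fin (g + 1)) d) : Point (Fin (g + 1)) d :=
  fun p => if p ∈ S then x p else z p

theorem glue_of_mem {g d : ℕ} {S : Finset (Site d)} (x z : Point (Fin (g + 1)) d) {p : Site d}
    (hp : p ∈ S) : glue S x z p = x p := if_pos hp

theorem glue_of_notMem {g d : ℕ} {S : Finset (Site d)} (x z : Point (Fin (g + 1)) d) {p : Site d}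
    (hp : p ∉ S) : glue S x z p = z p := if_neg hp

theorem glue_mem_stepShift {g d : ℕ} {S : Finset (Site d)} {x z : Point (Fin (g + 1)) d}
    (hx : x ∈ stepShift g d) (hz : z ∈ stepShift g d) (h : ∀ p ∈ boundary S, x p = z p) :
    glue S x z ∈ stepShift g d := by
  rw [mem_stepShift_iff] at *
  intro p q hpq
  by_cases hp : p ∈ S <;> by_cases hq : q ∈ S
  · rw [glue_of_mem x z hp, glue_of_mem x z hq]; exact hx p q hpq
  · rw [glue_of_mem x z hp, glue_of_notMem x z hq, ← h q (mem_boundary_of_adj hp hq hpq)]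
    exact hx p q hpq
  · rw [glue_of_notMem x z hp, glue_of_mem x z hq, ← h p (mem_boundary_of_adj hq hp hpq.symm)]
    exact hx p q hpq
  · rw [glue_of_notMem x z hp, glue_of_notMem x z hq]; exact hz p q hpq

theorem IsDLR.exists_mem_of_measure_ne_zero {g d : ℕ} {lam : ℝ} {μ : Measure (Point (Fin (g + 1)) d)}
    (hμ : IsDLR lam μ) {E : Set (Point (Fin (g + 1)) d)} (hE : μ E ≠ 0) :
    ∃ x ∈ stepShift g d, x ∈ E := by
  by_contra! h
  exact hE (measure_mono_null (fun x hx hxs => h x hxs hx) hμ.measure_compl)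

open scoped Classical in
theorem IsDLR.real_inter_cyl_eq_sum {g d : ℕ} {lam : ℝ} {μ : Measure (Point (Fin (g + 1)) d)}
    (hμ : IsDLR lam μ) {S T : Finset (Site d)} (hT : boundary S ⊆ T) (hTS : Disjoint T S)
    {ξ : Point (Fin (g + 1)) d} (hξ : ξ ∈ stepShift g d) {E : Set (Point (Fin (g + 1)) d)}
    (hE : ∀ x y : Point (Fin (g + 1)) d, (∀ p ∈ S, x p = y p) → (x ∈ E ↔ y ∈ E)) :
    μ.real (E ∩ cyl (T.restrict ξ)) =
      ∑ x ∈ fiber S ξ with x ∈ E, μ.real (cyl ((S ∪ T).restrict x)) := by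
  have := hμ.isProbabilityMeasure
  rw [← measureReal_biUnion_finset]
  · refine measureReal_congr ?_
    have hae : ∀ᵐ z ∂μ, z ∈ stepShift g d := hμ.measure_compl
    filter_upwards [hae] with z hz
    refine propext ⟨fun hzE => ?_, fun hzU => ?_⟩
    · obtain ⟨hzE, hzT⟩ := hzE
      rw [mem_cyl_restrict] at hzT
      have hg : ∀ p ∈ S, glue S z ξ p = z p := fun p hp => glue_of_mem z ξ hp
      refine Set.mem_iUnion₂.2 ⟨glue S z ξ, Finset.mem_filter.2 ⟨mem_fiber.2
        ⟨glue_mem_stepShift hz hξ fun p hp => hzT p (hT hp), fun p hp => glue_of_notMem z ξ hp⟩,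
        (hE _ _ hg).2 hzE⟩, mem_cyl_restrict.2 fun p hp => ?_⟩
      by_cases hpS : p ∈ S
      · exact (hg p hpS).symm
      · rw [glue_of_notMem z ξ hpS]
        exact hzT p ((Finset.mem_union.1 hp).resolve_left hpS)
    · obtain ⟨x, hx, hzx⟩ := Set.mem_iUnion₂.1 hzU
      obtain ⟨hxf, hxE⟩ := Finset.mem_filter.1 hx
      rw [mem_cyl_restrict] at hzx
      refine ⟨(hE z x fun p hp => hzx p (Finset.mem_union_left _ hp)).2 hxE,
        mem_cyl_restrict.2 fun p hp => ?_⟩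
      rw [hzx p (Finset.mem_union_right _ hp)]
      exact (mem_fiber.1 hxf).2 p (Finset.disjoint_left.1 hTS hp)
  · intro x hx y hy hxy
    refine Set.disjoint_left.2 fun z hzx hzy => hxy (funext fun p => ?_)
    rw [mem_cyl_restrict] at hzx hzy
    by_cases hp : p ∈ S
    · rw [← hzx p (Finset.mem_union_left _ hp), ← hzy p (Finset.mem_union_left _ hp)]
    · rw [(mem_fiber.1 (Finset.mem_filter.1 hx).1).2 p hp,
        (mem_fiber.1 (Finset.mem_filter.1 hy).1).2 p hp]
  · exact fun x _ => measurableSet_cyl _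

/-- Summing `ratio` over `fiber S ξ` normalises the cylinder measures, since almost every point of
the conditioning cylinder agrees on `S` with exactly one member of the fiber. -/
theorem IsDLR.real_inter_cyl {g d : ℕ} {lam : ℝ} (hl : 0 < lam)
    {μ : Measure (Point (Fin (g + 1)) d)}
    (hμ : IsDLR lam μ) {S T : Finset (Site d)} (hT : boundary S ⊆ T) (hTS : Disjoint T S)
    {ξ : Point (Fin (g + 1)) d} (hξ : ξ ∈ stepShift g d) {E : Set (Point (Fin (g + 1)) d)}
    (hE : ∀ x y : Point (Fin (g + 1)) d, (∀ p ∈ S, x p = y p) → (x ∈ E ↔ y ∈ E)) :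
    μ.real (E ∩ cyl (T.restrict ξ)) = prob lam S ξ E * μ.real (cyl (T.restrict ξ)) := by
  classical
  have htot : ∑ y ∈ fiber S ξ, μ.real (cyl ((S ∪ T).restrict y)) = μ.real (cyl (T.restrict ξ)) := by
    have h := hμ.real_inter_cyl_eq_sum hT hTS hξ (E := Set.univ) (by simp)
    simpa using h.symm
  have hone : ∀ x ∈ fiber S ξ, mass lam S ξ * μ.real (cyl ((S ∪ T).restrict x)) =
      wt lam S x * μ.real (cyl (T.restrict ξ)) := by
    intro x hx
    rw [mass, Finset.sum_mul, ← htot, Finset.mul_sum]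
    exact Finset.sum_congr rfl fun y hy => hμ.ratio S T hT hTS ξ x hx y hy
  have hm := mass_pos hl S hξ
  rw [hμ.real_inter_cyl_eq_sum hT hTS hξ hE, prob, div_mul_eq_mul_div, eq_div_iff hm.ne',
    Finset.sum_mul, Finset.sum_mul]
  refine Finset.sum_congr rfl fun x hx => ?_
  rw [mul_comm, hone x (Finset.mem_filter.1 hx).1]

theorem IsDLR.condProb_eq {g d : ℕ} {lam : ℝ} (hl : 0 < lam)
    {μ : Measure (Point (Fin (g + 1)) d)}
    (hμ : IsDLR lam μ) {S T U : Finset (Site d)} (hT : boundary S ⊆ T) (hTS : Disjoint T S)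
    (hU : U ⊆ S) {ξ : Point (Fin (g + 1)) d} (hξ : ξ ∈ stepShift g d)
    (hpos : 0 < μ (cyl (T.restrict ξ))) (u : Config (Fin (g + 1)) U) :
    condProb μ (T.restrict ξ) u = prob lam S ξ (cyl u) := by
  have := hμ.isProbabilityMeasure
  have hE : ∀ x y : Point (Fin (g + 1)) d, (∀ p ∈ S, x p = y p) → (x ∈ cyl u ↔ y ∈ cyl u) := by
    intro x y hxy
    have : U.restrict x = U.restrict y := funext fun p => hxy p.1 (hU p.2)
    simp only [cyl, Set.mem_ofPred_eq, this]
  have h := hμ.real_inter_cyl hl hT hTS hξ hE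
  have hpos' : 0 < μ.real (cyl (T.restrict ξ)) :=
    ENNReal.toReal_pos hpos.ne' (measure_ne_top _ _)
  rw [condProb, cond_apply (measurableSet_cyl _), ENNReal.toReal_mul, ENNReal.toReal_inv,
    Set.inter_comm, ← measureReal_def, ← measureReal_def, h]
  field_simp

/-! ### Existence -/

open scoped Classical in
/-- The finite-volume Gibbs distribution on `fiber W ξ` as a measure. -/
noncomputable def fiberMeasure {g d : ℕ} (lam : ℝ) (W : Finset (Site d))
    (ξ : Point (Fin (g + 1)) d) : Measure (Point (Fin (g + 1)) d) :=
  ∑ x ∈ fiber W ξ, ENNReal.ofReal (wt lam W x / mass lam W ξ) • Measure.dirac x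

open scoped Classical in
theorem fiberMeasure_apply {g d : ℕ} {lam : ℝ} (hl : 0 < lam) (W : Finset (Site d))
    {ξ : Point (Fin (g + 1)) d} (hξ : ξ ∈ stepShift g d) {E : Set (Point (Fin (g + 1)) d)}
    (hE : MeasurableSet E) : fiberMeasure lam W ξ E = ENNReal.ofReal (prob lam W ξ E) := by
  have hm := mass_pos hl W hξ
  rw [fiberMeasure, Measure.finsetSum_apply, prob, Finset.sum_div, ENNReal.ofReal_sum_of_nonneg
    fun x _ => (div_pos (wt_pos hl W x) hm).le, Finset.sum_filter]
  refine Finset.sum_congr rfl fun x _ => ?_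
  rw [Measure.smul_apply, Measure.dirac_apply' _ hE, smul_eq_mul]
  by_cases hx : x ∈ E <;> simp [hx]

theorem prob_nonneg {g d : ℕ} {lam : ℝ} (hl : 0 < lam) (W : Finset (Site d))
    (ξ : Point (Fin (g + 1)) d) (E : Set (Point (Fin (g + 1)) d)) : 0 ≤ prob lam W ξ E :=
  div_nonneg (Finset.sum_nonneg fun x _ => (wt_pos hl W x).le)
    (Finset.sum_nonneg fun x _ => (wt_pos hl W x).le)

theorem prob_univ {g d : ℕ} {lam : ℝ} (hl : 0 < lam) (W : Finset (Site d))
    {ξ : Point (Fin (g + 1)) d} (hξ : ξ ∈ stepShift g d) : prob lam W ξ Set.univ = 1 := by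
  simp only [prob, Set.mem_univ, Finset.filter_true]
  exact div_self (mass_pos hl W hξ).ne'

theorem wt_glue {g d : ℕ} (lam : ℝ) {S W : Finset (Site d)} (hS : S ⊆ W)
    (x z : Point (Fin (g + 1)) d) :
    wt lam W (glue S x z) * wt lam S z = wt lam W z * wt lam S x := by
  unfold wt
  rw [← Finset.prod_sdiff hS, ← Finset.prod_sdiff hS (f := fun p => lam ^ (z p : ℕ)),
    Finset.prod_congr rfl fun p hp => by rw [glue_of_notMem x z (Finset.mem_sdiff.1 hp).2],
    Finset.prod_congr (s₁ := S) rfl fun p hp => by rw [glue_of_mem x z hp]]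
  ring

-- Replacing the values on `S` by those of `y` is a bijection between the two cylinders inside
-- `fiber W ζ`; it is admissible because `T` pins `boundary S`, and it changes every weight by the
-- same factor.
open scoped Classical in
theorem prob_ratio {g d : ℕ} (lam : ℝ) {W S T : Finset (Site d)} (hSW : S ⊆ W)
    (hT : boundary S ⊆ T) (hTS : Disjoint T S) (ζ : Point (Fin (g + 1)) d)
    {ξ x y : Point (Fin (g + 1)) d} (hx : x ∈ fiber S ξ) (hy : y ∈ fiber S ξ) :
    wt lam S y * prob lam W ζ (cyl ((S ∪ T).restrict x)) =
      wt lam S x * prob lam W ζ (cyl ((S ∪ T).restrict y)) := by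
  rw [prob, prob, mul_div_assoc', mul_div_assoc', Finset.mul_sum, Finset.mul_sum]
  congr 1
  have hmap : ∀ {x y : Point (Fin (g + 1)) d}, x ∈ fiber S ξ → y ∈ fiber S ξ →
      ∀ z ∈ (fiber W ζ).filter (fun z => z ∈ cyl ((S ∪ T).restrict x)),
        glue S y z ∈ (fiber W ζ).filter (fun z => z ∈ cyl ((S ∪ T).restrict y)) ∧
          glue S x (glue S y z) = z ∧ wt lam S z = wt lam S x := by
    intro x y hx hy z hz
    obtain ⟨hzf, hzx⟩ := Finset.mem_filter.1 hz
    rw [mem_cyl_restrict] at hzx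
    rw [mem_fiber] at hzf hx hy
    have hyz : ∀ p ∈ T, y p = z p := fun p hp => by
      have hpS := Finset.disjoint_left.1 hTS hp
      rw [hzx p (Finset.mem_union_right _ hp), hx.2 p hpS, hy.2 p hpS]
    refine ⟨Finset.mem_filter.2 ⟨mem_fiber.2 ⟨glue_mem_stepShift hy.1 hzf.1
      fun p hp => hyz p (hT hp), fun p hp => ?_⟩, mem_cyl_restrict.2 fun p hp => ?_⟩,
      funext fun p => ?_, Finset.prod_congr rfl fun p hp => ?_⟩
    · rw [glue_of_notMem y z fun h => hp (hSW h), hzf.2 p hp]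
    · by_cases hpS : p ∈ S
      · rw [glue_of_mem y z hpS]
      · rw [glue_of_notMem y z hpS, hyz p ((Finset.mem_union.1 hp).resolve_left hpS)]
    · by_cases hpS : p ∈ S
      · rw [glue_of_mem _ _ hpS, hzx p (Finset.mem_union_left _ hpS)]
      · rw [glue_of_notMem _ _ hpS, glue_of_notMem _ _ hpS]
    · rw [hzx p (Finset.mem_union_left _ hp)]
  refine Finset.sum_nbij' (glue S y) (glue S x) (fun z hz => (hmap hx hy z hz).1)
    (fun z hz => (hmap hy hx z hz).1) (fun z hz => (hmap hx hy z hz).2.1)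
    (fun z hz => (hmap hy hx z hz).2.1) fun z hz => ?_
  have h := wt_glue lam hSW y z
  rw [(hmap hx hy z hz).2.2] at h
  linarith

/-- The set of points that violate the step condition at the edge `{p, p + e_i}`. -/
def badEdge (g : ℕ) {d : ℕ} (p : Site d) (i : Fin d) : Set (Point (Fin (g + 1)) d) :=
  {x | ¬ |((x p : ℕ) : ℤ) - ((x (p + basisVec i) : ℕ) : ℤ)| ≤ 1}

theorem isClopen_badEdge (g : ℕ) {d : ℕ} (p : Site d) (i : Fin d) : IsClopen (badEdge g p i) := by
  have hv : ∀ q : Site d, Continuous fun x : Point (Fin (g + 1)) d => ((x q : ℕ) : ℤ) := fun q =>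
    (continuous_of_discreteTopology (f := fun a : Fin (g + 1) => ((a : ℕ) : ℤ))).comp
      (continuous_apply q)
  have hc := (hv p).sub (hv (p + basisVec i))
  have hp := (isClopen_discrete {a : ℤ | ¬ |a| ≤ 1}).preimage hc
  have heq : badEdge g p i = (fun x : Point (Fin (g + 1)) d =>
      ((x p : ℕ) : ℤ) - ((x (p + basisVec i) : ℕ) : ℤ)) ⁻¹' {a : ℤ | ¬ |a| ≤ 1} := by
    ext x
    simp only [badEdge, Set.mem_preimage, Set.mem_ofPred_eq]
  rw [heq]
  exact hp

theorem compl_stepShift_eq (g d : ℕ) :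
    (stepShift g d)ᶜ = ⋃ (p : Site d) (i : Fin d), badEdge g p i := by
  ext x
  simp [stepShift, badEdge]

theorem isClosed_stepShift (g d : ℕ) : IsClosed (stepShift g d) := by
  rw [← isOpen_compl_iff, compl_stepShift_eq]
  exact isOpen_iUnion fun p => isOpen_iUnion fun i => (isClopen_badEdge g p i).isOpen

theorem zero_mem_stepShift (g d : ℕ) : (fun _ => 0) ∈ stepShift g d := by
  simp [stepShift]

/-- The probability measures on the full shift form a compact space, so the distributions with zero
boundary condition converge along an ultrafilter. The required identities involve only clopen sets,
whose probabilities converge, and hold in every volume containing `S`. -/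
theorem exists_isDLR (g d : ℕ) {lam : ℝ} (hl : 0 < lam) :
    ∃ μ : Measure (Point (Fin (g + 1)) d), IsDLR lam μ := by
  classical
  have h0 := zero_mem_stepShift g d
  set ζ : Point (Fin (g + 1)) d := fun _ => 0
  have hprob : ∀ W, IsProbabilityMeasure (fiberMeasure lam W ζ) := fun W =>
    ⟨by rw [fiberMeasure_apply hl W h0 MeasurableSet.univ, prob_univ hl W h0, ENNReal.ofReal_one]⟩
  set ν : Finset (Site d) → ProbabilityMeasure (Point (Fin (g + 1)) d) :=
    fun W => ⟨fiberMeasure lam W ζ, hprob W⟩ with hν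
  set F : Ultrafilter (Finset (Site d)) := Ultrafilter.of atTop with hF
  have hlim : Tendsto ν F (𝓝 (F.map ν).lim) := Ultrafilter.le_nhds_lim (F.map ν)
  set μ := (F.map ν).lim
  have hconv : ∀ E : Set (Point (Fin (g + 1)) d), IsClopen E →
      Tendsto (fun W => prob lam W ζ E) F (𝓝 ((μ : Measure _).real E)) := by
    intro E hE
    have h1 := ProbabilityMeasure.tendsto_measure_of_null_frontier_of_tendsto' hlim (E := E)
      (by rw [hE.frontier_eq, measure_empty])
    have h2 := (ENNReal.tendsto_toReal (measure_ne_top _ E)).comp h1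
    refine h2.congr fun W => ?_
    change (fiberMeasure lam W ζ E).toReal = _
    rw [fiberMeasure_apply hl W h0 hE.isOpen.measurableSet, ENNReal.toReal_ofReal (prob_nonneg hl _ _ _)]
  refine ⟨μ, inferInstance, ?_, fun S T hT hTS ξ x hx y hy => ?_⟩
  · rw [compl_stepShift_eq]
    refine measure_iUnion_null fun p => measure_iUnion_null fun i => ?_
    have hz : ∀ W, prob lam W ζ (badEdge g p i) = 0 := fun W => by
      rw [prob, Finset.filter_false_of_mem, Finset.sum_empty, zero_div]
      exact fun x hx hbad => hbad ((mem_fiber.1 hx).1 p i)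
    have h := hconv _ (isClopen_badEdge g p i)
    simp only [hz] at h
    exact (measureReal_eq_zero_iff).1 (tendsto_nhds_unique h tendsto_const_nhds)
  · refine tendsto_nhds_unique_of_eventuallyEq
      ((hconv _ (isClopen_cyl _)).const_mul _) ((hconv _ (isClopen_cyl _)).const_mul _) ?_
    have hS : ∀ᶠ W in (F : Filter (Finset (Site d))), S ⊆ W :=
      Ultrafilter.of_le atTop (eventually_ge_atTop S)
    filter_upwards [hS] with W hW
    exact prob_ratio lam hW hT hTS ζ hx hy

/-! ### Uniqueness and shift-invariance -/

/-- The cube `{-N, …, N}^d`. -/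
noncomputable def box (d N : ℕ) : Finset (Site d) := Finset.Icc (fun _ => -(N : ℤ)) (fun _ => (N : ℤ))

theorem mem_box_of_l1norm_le {d N : ℕ} {p : Site d} (hp : l1norm p ≤ N) : p ∈ box d N := by
  have h : ∀ i, (p i).natAbs ≤ N := fun i =>
    (Finset.single_le_sum (f := fun i => (p i).natAbs) (fun _ _ => Nat.zero_le _)
      (Finset.mem_univ i)).trans hp
  refine Finset.mem_Icc.2 ⟨fun i => ?_, fun i => ?_⟩
  · have := h i; simp only; omega
  · have := h i; simp only; omega

theorem exists_l1norm_le {d : ℕ} (S : Finset (Site d)) : ∃ n, ∀ p ∈ S, l1norm p ≤ n :=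
  ⟨S.sup l1norm, fun _ hp => Finset.le_sup hp⟩

theorem mem_cyl_iff_of_eqOn {g d : ℕ} {U : Finset (Site d)} (u : Config (Fin (g + 1)) U)
    (x y : Point (Fin (g + 1)) d) (h : ∀ p ∈ U, x p = y p) : x ∈ cyl u ↔ y ∈ cyl u := by
  have : U.restrict x = U.restrict y := funext fun p => h p.1 p.2
  simp only [cyl, Set.mem_ofPred_eq, this]

theorem IsDLR.exists_restrict_eq {g d : ℕ} {lam : ℝ} {μ : Measure (Point (Fin (g + 1)) d)}
    (hμ : IsDLR lam μ) {T : Finset (Site d)} {δ : Config (Fin (g + 1)) T} (hδ : μ (cyl δ) ≠ 0) :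
    ∃ ξ ∈ stepShift g d, T.restrict ξ = δ :=
  hμ.exists_mem_of_measure_ne_zero hδ

/-- The measure of a cylinder is an average of finite-volume probabilities over the boundary
condition on `W`, and each of these is close to the one for `ζ`. -/
theorem IsDLR.abs_real_cyl_sub_prob_le {g d : ℕ} {lam : ℝ} (hl : 2 ^ (2 * d + 3) ≤ lam)
    {μ : Measure (Point (Fin (g + 1)) d)} (hμ : IsDLR lam μ) {W U : Finset (Site d)}
    (hU : U ⊆ W) {ζ : Point (Fin (g + 1)) d} (hζ : ζ ∈ stepShift g d) {m : ℕ} (hm : 0 < m)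
    (hfar : ∀ p ∈ U, ∀ r ∈ boundary W, m + g ≤ l1norm (p - r)) (u : Config (Fin (g + 1)) U) :
    |μ.real (cyl u) - prob lam W ζ (cyl u)| ≤ U.card * (2 ^ (2 * d + 3) / lam) ^ m := by
  have hl0 : 0 < lam := lt_of_lt_of_le (by positivity) hl
  have := hμ.isProbabilityMeasure
  set b : ℝ := U.card * (2 ^ (2 * d + 3) / lam) ^ m
  set c := prob lam W ζ (cyl u)
  have hone : ∑ δ : Config (Fin (g + 1)) (boundary W), μ.real (cyl δ) = 1 := by
    have h := sum_real_inter_cyl μ (boundary W) MeasurableSet.univ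
    simpa using h
  have hterm : ∀ δ : Config (Fin (g + 1)) (boundary W),
      |μ.real (cyl u ∩ cyl δ) - c * μ.real (cyl δ)| ≤ b * μ.real (cyl δ) := by
    intro δ
    by_cases hδ : μ (cyl δ) = 0
    · have h1 : μ.real (cyl δ) = 0 := by rw [measureReal_def, hδ, ENNReal.toReal_zero]
      have h2 : μ.real (cyl u ∩ cyl δ) = 0 := by
        rw [measureReal_def, measure_mono_null Set.inter_subset_right hδ, ENNReal.toReal_zero]
      simp [h1, h2]
    · obtain ⟨ξ, hξ, rfl⟩ := hμ.exists_restrict_eq hδ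
      rw [hμ.real_inter_cyl hl0 Finset.Subset.rfl (disjoint_boundary W) hξ
        fun x y hxy => mem_cyl_iff_of_eqOn u x y fun p hp => hxy p (hU hp), ← sub_mul, abs_mul,
        abs_of_nonneg (measureReal_nonneg (μ := μ))]
      refine mul_le_mul_of_nonneg_right ?_ measureReal_nonneg
      exact abs_prob_sub_prob_le hl hU hξ hζ hm (fun p hp r hr _ => hfar p hp r hr)
        (mem_cyl_iff_of_eqOn u)
  calc |μ.real (cyl u) - c|
      = |∑ δ : Config (Fin (g + 1)) (boundary W),
          (μ.real (cyl u ∩ cyl δ) - c * μ.real (cyl δ))| := by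
        rw [Finset.sum_sub_distrib, ← Finset.mul_sum, hone, mul_one,
          sum_real_inter_cyl μ _ (measurableSet_cyl u)]
    _ ≤ ∑ δ : Config (Fin (g + 1)) (boundary W),
          |μ.real (cyl u ∩ cyl δ) - c * μ.real (cyl δ)| := Finset.abs_sum_le_sum_abs _ _
    _ ≤ ∑ δ : Config (Fin (g + 1)) (boundary W), b * μ.real (cyl δ) :=
        Finset.sum_le_sum fun δ _ => hterm δ
    _ = b := by rw [← Finset.mul_sum, hone, mul_one]

/-- In growing boxes both measures are compared with the same finite-volume probability, and the
error decays because the ratio is strictly below one. -/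
theorem IsDLR.unique {g d : ℕ} {lam : ℝ} (hl : 2 ^ (2 * d + 3) < lam)
    {μ ν : Measure (Point (Fin (g + 1)) d)} (hμ : IsDLR lam μ) (hν : IsDLR lam ν) : μ = ν := by
  have hl0 : 0 < lam := lt_trans (by positivity) hl
  have := hμ.isProbabilityMeasure
  have := hν.isProbabilityMeasure
  have hcyl : ∀ (U : Finset (Site d)) (u : Config (Fin (g + 1)) U), μ (cyl u) = ν (cyl u) := by
    intro U u
    obtain ⟨n, hn⟩ := exists_l1norm_le U
    have hr0 : (0 : ℝ) ≤ 2 ^ (2 * d + 3) / lam := by positivity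
    have hr1 : 2 ^ (2 * d + 3) / lam < 1 := (div_lt_one hl0).2 hl
    have hb : ∀ m : ℕ, |μ.real (cyl u) - ν.real (cyl u)| ≤
        2 * (U.card * (2 ^ (2 * d + 3) / lam) ^ (m + 1)) := by
      intro m
      have hUW : U ⊆ box d (n + (m + 1 + g)) := fun p hp =>
        mem_box_of_l1norm_le ((hn p hp).trans (Nat.le_add_right _ _))
      have hfar : ∀ p ∈ U, ∀ r ∈ boundary (box d (n + (m + 1 + g))),
          m + 1 + g ≤ l1norm (p - r) := by
        intro p hp r hr
        have h1 := hn p hp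
        have h2 : ¬ l1norm r ≤ n + (m + 1 + g) := fun h =>
          ((mem_boundary _ r).1 hr).1 (mem_box_of_l1norm_le h)
        have h3 := l1norm_sub_le r p 0
        rw [sub_zero, sub_zero, l1norm_sub_comm] at h3
        omega
      have e1 := hμ.abs_real_cyl_sub_prob_le hl.le hUW (zero_mem_stepShift g d)
        (m := m + 1) (by omega) hfar u
      have e2 := hν.abs_real_cyl_sub_prob_le hl.le hUW (zero_mem_stepShift g d)
        (m := m + 1) (by omega) hfar u
      rw [abs_le] at e1 e2 ⊢
      constructor <;> linarith [e1.1, e1.2, e2.1, e2.2]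
    have hlim : Tendsto (fun m : ℕ => 2 * ((U.card : ℝ) * (2 ^ (2 * d + 3) / lam) ^ (m + 1)))
        atTop (𝓝 (2 * ((U.card : ℝ) * 0))) :=
      (((tendsto_pow_atTop_nhds_zero_of_lt_one hr0 hr1).comp
        (tendsto_add_atTop_nat 1)).const_mul _).const_mul _
    have h0 := ge_of_tendsto' hlim hb
    rw [mul_zero, mul_zero] at h0
    have h1 : μ.real (cyl u) = ν.real (cyl u) := sub_eq_zero.1 (abs_nonpos_iff.1 h0)
    exact (ENNReal.toReal_eq_toReal_iff' (measure_ne_top _ _) (measure_ne_top _ _)).1 h1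
  refine IsProjectiveLimit.unique (P := fun I => μ.map I.restrict) (fun I => rfl) fun I => ?_
  refine Measure.ext_of_singleton fun u => ?_
  rw [Measure.map_apply (Finset.measurable_restrict I) (measurableSet_singleton u),
    Measure.map_apply (Finset.measurable_restrict I) (measurableSet_singleton u)]
  exact (hcyl I u).symm

theorem measurable_shift {g d : ℕ} (a : Site d) :
    Measurable (shift a : Point (Fin (g + 1)) d → Point (Fin (g + 1)) d) :=
  measurable_pi_lambda _ fun q => measurable_pi_apply (a + q)

theorem adj_add_left {d : ℕ} (a : Site d) {p q : Site d} : Adj (a + p) (a + q) ↔ Adj p q := by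
  rw [Adj, Adj, add_sub_add_left_eq_sub]

theorem shift_mem_stepShift {g d : ℕ} (a : Site d) {x : Point (Fin (g + 1)) d}
    (hx : x ∈ stepShift g d) : shift a x ∈ stepShift g d := by
  rw [mem_stepShift_iff] at *
  exact fun p q hpq => hx _ _ ((adj_add_left a).2 hpq)

theorem IsDLR.map_shift {g d : ℕ} {lam : ℝ} {μ : Measure (Point (Fin (g + 1)) d)}
    (hμ : IsDLR lam μ) (a : Site d) : IsDLR lam (μ.map (shift a)) := by
  have := hμ.isProbabilityMeasure
  have hms := measurable_shift (g := g) a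
  set e : Site d ↪ Site d := addLeftEmbedding a with he
  have hback : ∀ (x : Point (Fin (g + 1)) d) p, shift (-a) x (a + p) = x p := fun x p => by
    simp [shift]
  have hcyl : ∀ (V : Finset (Site d)) (x : Point (Fin (g + 1)) d),
      (μ.map (shift a)).real (cyl (V.restrict x)) =
        μ.real (cyl ((V.map e).restrict (shift (-a) x))) := by
    intro V x
    rw [measureReal_def, Measure.map_apply hms (measurableSet_cyl _), measureReal_def]
    congr 2
    ext z
    rw [Set.mem_preimage, mem_cyl_restrict, mem_cyl_restrict]
    simp only [Finset.mem_map, forall_exists_index, and_imp, forall_apply_eq_imp_iff₂, he,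
      addLeftEmbedding_apply, hback]
    rfl
  have hwt : ∀ (S : Finset (Site d)) (x : Point (Fin (g + 1)) d),
      wt lam (S.map e) (shift (-a) x) = wt lam S x := by
    intro S x
    rw [wt, Finset.prod_map]
    simp only [he, addLeftEmbedding_apply, hback, wt]
  have hfib : ∀ {S : Finset (Site d)} {ξ x : Point (Fin (g + 1)) d}, x ∈ fiber S ξ →
      shift (-a) x ∈ fiber (S.map e) (shift (-a) ξ) := by
    intro S ξ x hx
    rw [mem_fiber] at hx ⊢
    refine ⟨shift_mem_stepShift _ hx.1, fun p hp => hx.2 _ fun h => hp ?_⟩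
    exact Finset.mem_map.2 ⟨-a + p, h, by simp [he]⟩
  refine ⟨Measure.isProbabilityMeasure_map hms.aemeasurable, ?_,
    fun S T hT hTS ξ x hx y hy => ?_⟩
  · rw [Measure.map_apply hms (isClosed_stepShift g d).isOpen_compl.measurableSet]
    refine measure_mono_null (fun x hx hxs => hx (shift_mem_stepShift a hxs)) hμ.measure_compl
  · rw [hcyl, hcyl, ← hwt S x, ← hwt S y, Finset.map_union]
    refine hμ.ratio (S.map e) (T.map e) (fun p hp => ?_) ?_ (shift (-a) ξ) _ (hfib hx) _ (hfib hy)
    · obtain ⟨hpS, q, hq, hpq⟩ := (mem_boundary _ p).1 hp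
      obtain ⟨q', hq', rfl⟩ := Finset.mem_map.1 hq
      have hp' : p = a + (-a + p) := by abel
      rw [hp'] at hpS hpq ⊢
      refine Finset.mem_map.2 ⟨-a + p, hT ((mem_boundary _ _).2
        ⟨fun h => hpS (Finset.mem_map.2 ⟨_, h, rfl⟩), q', hq', (adj_add_left a).1 hpq⟩), rfl⟩
    · exact (Finset.disjoint_map e).2 hTS

theorem IsDLR.measurePreserving_shift {g d : ℕ} {lam : ℝ} (hl : 2 ^ (2 * d + 3) < lam)
    {μ : Measure (Point (Fin (g + 1)) d)} (hμ : IsDLR lam μ) (a : Site d) :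
    MeasurePreserving (shift a) μ μ :=
  ⟨measurable_shift a, (hμ.map_shift a).unique hl hμ⟩

/-! ### Full support -/

theorem exists_interpolation {g d : ℕ} {x z : Point (Fin (g + 1)) d} (hx : x ∈ stepShift g d)
    (hz : z ∈ stepShift g d) (n : ℕ) : ∃ y ∈ stepShift g d, (∀ p, l1norm p ≤ n → y p = x p) ∧
      ∀ p, n + 2 * g ≤ l1norm p → y p = z p := by
  set ρ : Site d → ℕ := fun p => l1norm p - n with hρ
  -- Going outwards, `max x ρ` climbs from `x` until it reaches `g` by `ρ = g`. The other term stays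
  -- at `g` up to there and has come down to `z` by `ρ = 2 * g`.
  set h : Site d → ℕ := fun p => min (min g (max (z p : ℕ) (2 * g - ρ p))) (max (x p : ℕ) (ρ p)) with hh
  have hhg : ∀ p, h p < g + 1 := fun p => by simp only [hh]; omega
  rw [mem_stepShift_iff] at hx hz
  refine ⟨fun p => ⟨h p, hhg p⟩, mem_stepShift_iff.2 fun p q hpq => ?_, fun p hp => ?_,
    fun p hp => ?_⟩
  · have h1 := hx p q hpq
    have h2 := hz p q hpq
    have h3 := hpq.l1norm_le 0
    have h4 := hpq.symm.l1norm_le 0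
    rw [sub_zero, sub_zero] at h3 h4
    have h5 : ρ p ≤ ρ q + 1 := by simp only [hρ]; omega
    have h6 : ρ q ≤ ρ p + 1 := by simp only [hρ]; omega
    have h7 : max (z p : ℕ) (2 * g - ρ p) ≤ max (z q : ℕ) (2 * g - ρ q) + 1 := by omega
    simp only [hh]
    omega
  · have h1 := (x p).2
    refine Fin.ext ?_
    simp only [hh, hρ]
    omega
  · have h1 := (z p).2
    refine Fin.ext ?_
    simp only [hh, hρ]
    omega

/-- Some boundary condition on a large box has positive measure, and interpolation extends it to a
point showing the pattern of `x`, which has positive conditional probability. -/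
theorem IsDLR.measure_cyl_pos {g d : ℕ} {lam : ℝ} (hl : 0 < lam)
    {μ : Measure (Point (Fin (g + 1)) d)} (hμ : IsDLR lam μ) {x : Point (Fin (g + 1)) d}
    (hx : x ∈ stepShift g d) (V : Finset (Site d)) : 0 < μ (cyl (V.restrict x)) := by
  classical
  have := hμ.isProbabilityMeasure
  obtain ⟨n, hn⟩ := exists_l1norm_le V
  set W := box d (n + 2 * g) with hW
  obtain ⟨δ, hδ⟩ : ∃ δ : Config (Fin (g + 1)) (boundary W), μ.real (cyl δ) ≠ 0 := by
    by_contra! h0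
    have h := sum_real_inter_cyl μ (boundary W) MeasurableSet.univ
    simp [h0] at h
  have hδ' : μ (cyl δ) ≠ 0 := fun h => hδ (by rw [measureReal_def, h, ENNReal.toReal_zero])
  obtain ⟨z, hz, rfl⟩ := hμ.exists_restrict_eq hδ'
  obtain ⟨y, hy, hyx, hyz⟩ := exists_interpolation hx hz n
  have hVW : V ⊆ W := fun p hp => mem_box_of_l1norm_le ((hn p hp).trans (Nat.le_add_right _ _))
  have hyW : y ∈ fiber W z := mem_fiber.2 ⟨hy, fun p hp => hyz p (by
    by_contra h
    exact hp (mem_box_of_l1norm_le (by omega)))⟩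
  have hreal := hμ.real_inter_cyl hl Finset.Subset.rfl (disjoint_boundary W) hz
    (E := cyl (V.restrict x)) fun x' y' hxy =>
      mem_cyl_iff_of_eqOn _ x' y' fun p hp => hxy p (hVW hp)
  have hprob : 0 < prob lam W z (cyl (V.restrict x)) := by
    refine div_pos (Finset.sum_pos (fun x _ => wt_pos hl W x) ⟨y, Finset.mem_filter.2 ⟨hyW, ?_⟩⟩)
      (mass_pos hl W hz)
    exact mem_cyl_restrict.2 fun p hp => hyx p (hn p hp)
  refine pos_iff_ne_zero.2 fun h0 => ?_
  rw [measureReal_def, measure_mono_null Set.inter_subset_left h0, ENNReal.toReal_zero] at hreal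
  exact (mul_ne_zero hprob.ne' hδ) hreal.symm

theorem exists_cyl_subset {g d : ℕ} {x : Point (Fin (g + 1)) d} {O : Set (Point (Fin (g + 1)) d)}
    (hO : O ∈ 𝓝 x) : ∃ V : Finset (Site d), cyl (V.restrict x) ⊆ O := by
  rw [nhds_pi, Filter.mem_pi] at hO
  obtain ⟨I, hI, t, ht, hsub⟩ := hO
  refine ⟨hI.toFinset, fun z hz => hsub fun i hi => ?_⟩
  rw [mem_cyl_restrict.1 hz i (hI.mem_toFinset.2 hi)]
  exact mem_of_mem_nhds (ht i)

theorem IsDLR.support_eq {g d : ℕ} {lam : ℝ} (hl : 0 < lam)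
    {μ : Measure (Point (Fin (g + 1)) d)} (hμ : IsDLR lam μ) : μ.support = stepShift g d := by
  refine Set.Subset.antisymm (Measure.support_subset_of_isClosed (isClosed_stepShift g d)
    hμ.measure_compl) fun x hx => ?_
  rw [Measure.mem_support_iff_forall]
  intro O hO
  obtain ⟨V, hV⟩ := exists_cyl_subset hO
  exact (hμ.measure_cyl_pos hl hx V).trans_le (measure_mono hV)

/-! ### The energy of the step interaction -/

theorem stepInteraction_sft (g d : ℕ) (lam : ℝ) : (stepInteraction g d lam).sft = stepShift g d := by
  ext x
  simp [NNInteraction.sft, stepInteraction, stepShift]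

theorem expNeg_energy_of_valid {g d : ℕ} {lam : ℝ} (hl : 0 < lam) {V : Finset (Site d)}
    (x : Point (Fin (g + 1)) d)
    (hx : ∀ p ∈ V, ∀ i, p + basisVec i ∈ V →
      |((x p : ℕ) : ℤ) - ((x (p + basisVec i) : ℕ) : ℤ)| ≤ 1) :
    expNeg ((stepInteraction g d lam).energy (V.restrict x)) = wt lam V x := by
  have h0 : (∑ i : Fin d, ∑ p : V,
      if h : p.1 + basisVec i ∈ V then (stepInteraction g d lam).edge i (V.restrict x p)
        (V.restrict x ⟨p.1 + basisVec i, h⟩) else (0 : WithTop ℝ)) = 0 := by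
    refine Finset.sum_eq_zero fun i _ => Finset.sum_eq_zero fun p _ => ?_
    split_ifs with h
    · exact if_pos (hx p.1 p.2 i h)
    · rfl
  rw [NNInteraction.energy, h0, add_zero, ← WithTop.coe_sum]
  change Real.exp (-∑ p : V, -((x p.1 : ℕ) : ℝ) * Real.log lam) = _
  rw [← Finset.sum_neg_distrib, Real.exp_sum, wt, ← Finset.prod_coe_sort V]
  refine Finset.prod_congr rfl fun p _ => ?_
  rw [neg_mul, neg_neg, Real.exp_nat_mul, Real.exp_log hl]

theorem expNeg_energy_of_not_valid {g d : ℕ} {lam : ℝ} {V : Finset (Site d)}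
    (x : Point (Fin (g + 1)) d) {p : Site d} (hp : p ∈ V) {i : Fin d} (hpi : p + basisVec i ∈ V)
    (hx : ¬ |((x p : ℕ) : ℤ) - ((x (p + basisVec i) : ℕ) : ℤ)| ≤ 1) :
    expNeg ((stepInteraction g d lam).energy (V.restrict x)) = 0 := by
  have htop : (∑ i : Fin d, ∑ p : V,
      if h : p.1 + basisVec i ∈ V then (stepInteraction g d lam).edge i (V.restrict x p)
        (V.restrict x ⟨p.1 + basisVec i, h⟩) else (0 : WithTop ℝ)) = ⊤ := by
    refine WithTop.sum_eq_top.2 ⟨i, Finset.mem_univ i, WithTop.sum_eq_top.2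
      ⟨⟨p, hp⟩, Finset.mem_univ _, ?_⟩⟩
    rw [dif_pos hpi]
    exact if_neg hx
  rw [NNInteraction.energy, htop, add_top]
  rfl

/-- The extension of a configuration by the values of `ξ`. -/
def extend {A : Type*} {d : ℕ} {S : Finset (Site d)} (w : Config A S) (ξ : Point A d) :
    Point A d :=
  fun p => if h : p ∈ S then w ⟨p, h⟩ else ξ p

theorem restrict_extend {A : Type*} {d : ℕ} {S : Finset (Site d)} (w : Config A S)
    (ξ : Point A d) : S.restrict (extend w ξ) = w :=
  funext fun p => dif_pos p.2

theorem extend_of_notMem {A : Type*} {d : ℕ} {S : Finset (Site d)} (w : Config A S)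
    (ξ : Point A d) {p : Site d} (hp : p ∉ S) : extend w ξ p = ξ p :=
  dif_neg hp

theorem extend_restrict {A : Type*} {d : ℕ} {S : Finset (Site d)} {x ξ : Point A d}
    (h : ∀ p ∉ S, x p = ξ p) : extend (S.restrict x) ξ = x := by
  funext p
  by_cases hp : p ∈ S
  · exact dif_pos hp
  · rw [extend_of_notMem _ _ hp, h p hp]

theorem concat_restrict {A : Type*} {d : ℕ} {S T : Finset (Site d)}
    (w : Config A S) (ξ : Point A d) :
    concat w (T.restrict ξ) = (S ∪ T).restrict (extend w ξ) := by
  funext p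
  by_cases hp : p.1 ∈ S <;> simp [concat, extend, hp, Finset.restrict]

-- A violated edge must touch `S`, as `ξ` is admissible, so it lies in `S ∪ boundary S` and is seen
-- by the energy. The boundary weight does not depend on `w` and cancels in the specification.
open scoped Classical in
theorem expNeg_energy_concat {g d : ℕ} {lam : ℝ} (hl : 0 < lam) (S : Finset (Site d))
    {ξ : Point (Fin (g + 1)) d} (hξ : ξ ∈ stepShift g d) (w : Config (Fin (g + 1)) S) :
    expNeg ((stepInteraction g d lam).energy (concat w ((boundary S).restrict ξ))) =
      if extend w ξ ∈ stepShift g d then wt lam S (extend w ξ) * wt lam (boundary S) ξ else 0 := by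
  have hd := disjoint_boundary S
  rw [concat_restrict]
  split_ifs with h
  · rw [expNeg_energy_of_valid hl _ fun p _ i _ => h p i, wt, Finset.prod_union hd.symm]
    congr 1
    refine Finset.prod_congr rfl fun p hp => ?_
    rw [extend_of_notMem w ξ (Finset.disjoint_left.1 hd hp)]
  · simp only [stepShift, Set.mem_ofPred_eq, not_forall] at h
    obtain ⟨p, i, hpi⟩ := h
    have hadj := adj_add_basisVec p i
    have hmem : p ∈ S ∨ p + basisVec i ∈ S := by
      by_contra! hcon
      rw [extend_of_notMem w ξ hcon.1, extend_of_notMem w ξ hcon.2] at hpi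
      exact hpi (hξ p i)
    have hmem' : p ∈ S ∪ boundary S ∧ p + basisVec i ∈ S ∪ boundary S := by
      rw [Finset.mem_union, Finset.mem_union]
      rcases hmem with h | h
      · exact ⟨Or.inl h, or_iff_not_imp_left.2 fun h' => mem_boundary_of_adj h h' hadj⟩
      · exact ⟨or_iff_not_imp_left.2 fun h' => mem_boundary_of_adj h h' hadj.symm, Or.inl h⟩
    exact expNeg_energy_of_not_valid _ hmem'.1 hmem'.2 hpi

theorem partitionFn_eq {g d : ℕ} {lam : ℝ} (hl : 0 < lam) (S : Finset (Site d))
    {ξ : Point (Fin (g + 1)) d} (hξ : ξ ∈ stepShift g d) :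
    (stepInteraction g d lam).partitionFn S ((boundary S).restrict ξ) =
      mass lam S ξ * wt lam (boundary S) ξ := by
  classical
  rw [NNInteraction.partitionFn]
  simp only [expNeg_energy_concat hl S hξ]
  rw [← Finset.sum_filter, ← Finset.sum_mul, mass]
  congr 1
  refine Finset.sum_nbij' (fun w => extend w ξ) S.restrict (fun w hw => ?_) (fun x hx => ?_)
    (fun w _ => restrict_extend w ξ) (fun x hx => extend_restrict (mem_fiber.1 hx).2)
    fun w _ => rfl
  · exact mem_fiber.2 ⟨(Finset.mem_filter.1 hw).2, fun p hp => extend_of_notMem w ξ hp⟩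
  · refine Finset.mem_filter.2 ⟨Finset.mem_univ _, ?_⟩
    rw [extend_restrict (mem_fiber.1 hx).2]
    exact (mem_fiber.1 hx).1

theorem spec_eq_prob {g d : ℕ} {lam : ℝ} (hl : 0 < lam) (S : Finset (Site d))
    {ξ : Point (Fin (g + 1)) d} (hξ : ξ ∈ stepShift g d) (w : Config (Fin (g + 1)) S) :
    (stepInteraction g d lam).spec S ((boundary S).restrict ξ) w = prob lam S ξ (cyl w) := by
  classical
  rw [NNInteraction.spec, partitionFn_eq hl S hξ, expNeg_energy_concat hl S hξ, prob]
  have huniq : ∀ x ∈ fiber S ξ, x ∈ cyl w → x = extend w ξ := fun x hx hxw => by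
    have hxw' : S.restrict x = w := hxw
    rw [← hxw', extend_restrict (mem_fiber.1 hx).2]
  have hc := wt_pos hl (boundary S) ξ
  split_ifs with h
  · have hsum : (fiber S ξ).filter (fun x => x ∈ cyl w) = {extend w ξ} := by
      ext x
      rw [Finset.mem_filter, Finset.mem_singleton]
      refine ⟨fun hx => huniq x hx.1 hx.2, ?_⟩
      rintro rfl
      exact ⟨mem_fiber.2 ⟨h, fun p hp => extend_of_notMem w ξ hp⟩, restrict_extend w ξ⟩
    rw [hsum, Finset.sum_singleton, mul_div_mul_right _ _ hc.ne']
  · rw [zero_div, Finset.filter_false_of_mem, Finset.sum_empty, zero_div]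
    intro x hx hxw
    exact h (huniq x hx hxw ▸ (mem_fiber.1 hx).1)

/-! ### The Gibbs property and strong spatial mixing -/

theorem IsDLR.isMRF {g d : ℕ} {lam : ℝ} (hl : 2 ^ (2 * d + 3) < lam)
    {μ : Measure (Point (Fin (g + 1)) d)} (hμ : IsDLR lam μ) : IsMRF μ where
  isProbabilityMeasure := hμ.isProbabilityMeasure
  shift_invariant := hμ.measurePreserving_shift hl
  markov := by
    intro S T hT hTS u δ hδ
    have hl0 : 0 < lam := lt_trans (by positivity) hl
    have := hμ.isProbabilityMeasure
    obtain ⟨ξ, hξ, rfl⟩ := hμ.exists_restrict_eq hδ.ne'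
    have hsub : cyl (T.restrict ξ) ⊆ cyl ((boundary S).restrict ξ) := fun z hz =>
      mem_cyl_restrict.2 fun p hp => mem_cyl_restrict.1 hz p (hT hp)
    have hδ' : 0 < μ (cyl ((boundary S).restrict ξ)) := hδ.trans_le (measure_mono hsub)
    have e1 := hμ.condProb_eq hl0 hT hTS Finset.Subset.rfl hξ hδ u
    have e2 := hμ.condProb_eq hl0 Finset.Subset.rfl (disjoint_boundary S) Finset.Subset.rfl hξ
      hδ' u
    have := cond_isProbabilityMeasure hδ.ne'
    have := cond_isProbabilityMeasure hδ'.ne'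
    exact (ENNReal.toReal_eq_toReal_iff' (measure_ne_top _ _) (measure_ne_top _ _)).1
      (e1.trans e2.symm)

theorem IsDLR.isNNGibbs {g d : ℕ} {lam : ℝ} (hl : 2 ^ (2 * d + 3) < lam)
    {μ : Measure (Point (Fin (g + 1)) d)} (hμ : IsDLR lam μ) :
    IsNNGibbs (stepInteraction g d lam) μ where
  isMRF := hμ.isMRF hl
  gibbs := by
    intro S δ hδ
    have hl0 : 0 < lam := lt_trans (by positivity) hl
    obtain ⟨ξ, hξ, rfl⟩ := hμ.exists_restrict_eq hδ.ne'
    refine ⟨?_, fun w => ?_⟩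
    · rw [partitionFn_eq hl0 S hξ]
      exact mul_pos (mass_pos hl0 S hξ) (wt_pos hl0 _ _)
    · rw [spec_eq_prob hl0 S hξ, hμ.condProb_eq hl0 Finset.Subset.rfl (disjoint_boundary S)
        Finset.Subset.rfl hξ hδ]

theorem prob_le_one {g d : ℕ} {lam : ℝ} (hl : 0 < lam) (W : Finset (Site d))
    {ξ : Point (Fin (g + 1)) d} (hξ : ξ ∈ stepShift g d) (E : Set (Point (Fin (g + 1)) d)) :
    prob lam W ξ E ≤ 1 := by
  classical
  refine (div_le_one (mass_pos hl W hξ)).2 ?_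
  exact Finset.sum_le_sum_of_subset_of_nonneg (Finset.filter_subset _ _)
    fun x _ _ => (wt_pos hl W x).le

theorem setDist_le {d : ℕ} {A B : Set (Site d)} {p q : Site d} (hp : p ∈ A) (hq : q ∈ B) :
    setDist A B ≤ (l1norm (p - q) : ℕ) :=
  (iInf₂_le p hp).trans (iInf₂_le q hq)

theorem IsDLR.isSSM {g d : ℕ} {α lam : ℝ} (hα : 0 < α)
    (hl : 2 ^ (2 * d + 3) * Real.exp α ≤ lam) {μ : Measure (Point (Fin (g + 1)) d)}
    (hμ : IsDLR lam μ) :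
    IsSSM μ fun n : ℕ => Real.exp (α * g) * Real.exp (-α * (n : ℝ)) := by
  have hlt : 2 ^ (2 * d + 3) < lam := lt_of_lt_of_le
    (lt_mul_of_one_lt_right (by positivity) (Real.one_lt_exp_iff.2 hα)) hl
  have hl0 : 0 < lam := lt_trans (by positivity) hlt
  have hr : 2 ^ (2 * d + 3) / lam ≤ Real.exp (-α) := by
    rw [Real.exp_neg, div_le_iff₀ hl0, inv_mul_eq_div, le_div_iff₀ (Real.exp_pos α)]
    exact hl
  refine ⟨hμ.isMRF hlt, fun n => by positivity, ?_, ?_⟩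
  · have h1 : Tendsto (fun n : ℕ => Real.exp (α * g) * Real.exp (-α) ^ n) atTop
        (𝓝 (Real.exp (α * g) * 0)) :=
      (tendsto_pow_atTop_nhds_zero_of_lt_one (Real.exp_pos _).le
        (by rw [← Real.exp_zero]; exact Real.exp_lt_exp.2 (by linarith))).const_mul _
    rw [mul_zero] at h1
    refine h1.congr fun n => ?_
    rw [← Real.exp_nat_mul, mul_comm (n : ℝ)]
  · intro W U hU u δ₁ δ₂ hδ₁ hδ₂
    obtain ⟨ξ₁, hξ₁, rfl⟩ := hμ.exists_restrict_eq hδ₁.ne'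
    obtain ⟨ξ₂, hξ₂, rfl⟩ := hμ.exists_restrict_eq hδ₂.ne'
    -- Equal boundary conditions and empty `U` are treated apart, since only then is the distance
    -- infinite.
    rcases eq_or_ne ((boundary W).restrict ξ₁) ((boundary W).restrict ξ₂) with heq | hne
    · rw [heq, sub_self, abs_zero]
      refine mul_nonneg (Nat.cast_nonneg _) ?_
      induction setDist (U : Set (Site d)) _ using ENat.recTopCoe with
      | top => exact le_rfl
      | coe n => exact (by positivity : 0 ≤ Real.exp (α * g) * Real.exp (-α * (n : ℝ)))
    rw [hμ.condProb_eq hl0 Finset.Subset.rfl (disjoint_boundary W) hU hξ₁ hδ₁,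
      hμ.condProb_eq hl0 Finset.Subset.rfl (disjoint_boundary W) hU hξ₂ hδ₂]
    have hbound : ∀ m : ℕ, 0 < m →
        (∀ p ∈ U, ∀ r ∈ boundary W, ξ₁ r ≠ ξ₂ r → m + g ≤ l1norm (p - r)) →
        |prob lam W ξ₁ (cyl u) - prob lam W ξ₂ (cyl u)| ≤
          U.card * (2 ^ (2 * d + 3) / lam) ^ m := fun m hm hfar =>
      abs_prob_sub_prob_le hlt.le hU hξ₁ hξ₂ hm hfar (mem_cyl_iff_of_eqOn u)
    rcases U.eq_empty_or_nonempty with rfl | ⟨p₀, hp₀⟩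
    · have h := hbound 1 one_pos (by simp)
      simpa using h
    obtain ⟨r₀, hr₀, hne₀⟩ : ∃ r, ∃ h : r ∈ boundary W, ξ₁ r ≠ ξ₂ r := by
      by_contra! hcon
      exact hne (funext fun r => hcon r.1 r.2)
    set D := disagreement ((boundary W).restrict ξ₁) ((boundary W).restrict ξ₂) with hD
    have hmemD : ∀ r ∈ boundary W, ξ₁ r ≠ ξ₂ r → r ∈ D := fun r hr h => ⟨hr, h⟩
    have hle₀ := setDist_le (A := (U : Set (Site d))) hp₀ (hmemD r₀ hr₀ hne₀)
    obtain ⟨n, hn⟩ := ENat.ne_top_iff_exists.1 (ne_top_of_le_ne_top (ENat.natCast_ne_top _) hle₀)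
    have hfar : ∀ p ∈ U, ∀ r ∈ boundary W, ξ₁ r ≠ ξ₂ r → n ≤ l1norm (p - r) := by
      intro p hp r hr h
      have h1 := setDist_le (A := (U : Set (Site d))) hp (hmemD r hr h)
      rw [← hn] at h1
      exact_mod_cast h1
    rw [← hn]
    change _ ≤ (U.card : ℝ) * (Real.exp (α * g) * Real.exp (-α * (n : ℝ)))
    rw [← Real.exp_add]
    -- Beyond distance `g` the estimate applies with `m = n - g`, and the constant `exp (α * g)`
    -- pays for the lost `g`. Up to distance `g` the right-hand side is at least one.
    rcases Nat.lt_or_ge g n with hgn | hgn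
    · refine (hbound (n - g) (by omega) fun p hp r hr h => ?_).trans ?_
      · have := hfar p hp r hr h
        omega
      · refine mul_le_mul_of_nonneg_left ?_ (Nat.cast_nonneg _)
        calc (2 ^ (2 * d + 3) / lam) ^ (n - g) ≤ Real.exp (-α) ^ (n - g) :=
              pow_le_pow_left₀ (by positivity) hr _
          _ = _ := by
              rw [← Real.exp_nat_mul, Nat.cast_sub hgn.le]
              congr 1
              ring
    · have h1 : (1 : ℝ) ≤ U.card := by
        exact_mod_cast Finset.card_pos.2 ⟨p₀, hp₀⟩
      have h2 : 1 ≤ Real.exp (α * g + -α * n) := by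
        refine Real.one_le_exp ?_
        have : (n : ℝ) ≤ g := by exact_mod_cast hgn
        nlinarith
      have h3 : |prob lam W ξ₁ (cyl u) - prob lam W ξ₂ (cyl u)| ≤ 1 := by
        have a1 := prob_nonneg hl0 W ξ₁ (cyl u)
        have a2 := prob_nonneg hl0 W ξ₂ (cyl u)
        have a3 := prob_le_one hl0 W hξ₁ (cyl u)
        have a4 := prob_le_one hl0 W hξ₂ (cyl u)
        rw [abs_le]
        constructor <;> linarith
      exact h3.trans (one_le_mul_of_one_le_of_one_le h1 h2)

end SSM

theorem mainTheorem8 (g d : ℕ) (α : ℝ) (hα : 0 < α) :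
    ∃ lam₀ : ℝ, 0 < lam₀ ∧ ∀ lam : ℝ, lam₀ ≤ lam →
      (SSM.stepInteraction g d lam).sft = SSM.stepShift g d ∧
      ∃ μ : MeasureTheory.Measure (SSM.Point (Fin (g + 1)) d),
        SSM.IsNNGibbs (SSM.stepInteraction g d lam) μ ∧
        μ.support = SSM.stepShift g d ∧
        ∃ C : ℝ, 0 < C ∧ SSM.IsSSM μ (fun n : ℕ => C * Real.exp (-α * (n : ℝ))) := by
  -- This threshold makes the Peierls ratio `2 ^ (2 * d + 3) / lam` at most `exp (-α)`.
  refine ⟨2 ^ (2 * d + 3) * Real.exp α, by positivity, fun lam hl => ?_⟩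
  have hlt : 2 ^ (2 * d + 3) < lam := lt_of_lt_of_le
    (lt_mul_of_one_lt_right (by positivity) (Real.one_lt_exp_iff.2 hα)) hl
  have hl0 : 0 < lam := lt_trans (by positivity) hlt
  obtain ⟨μ, hμ⟩ := SSM.exists_isDLR g d hl0
  exact ⟨SSM.stepInteraction_sft g d lam, μ, hμ.isNNGibbs hlt, hμ.support_eq hl0,
    Real.exp (α * g), Real.exp_pos _, hμ.isSSM hα hl⟩
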